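/- **Setting.** Let $\sigma\colon F_k\hookrightarrow \mathrm{Out}(F_n)$ be a monomorphism between a free group of finite rank $k$ with basis $t_1,\dots,t_k$ and the outer automorphism group of the free group $F_n=\langle x_1,\dots,x_n\rangle$, such that every element of $\sigma(F_k)$ is unipotent (acts unipotently on $H_1(F_n;\mathbb Z)$). Let $\Gamma$ be a finite connected filtered graph: its 1-cells, each with a positive orientation, are totally ordered ("height"), each stage of the filtration adding one cell. Fix a maximal tree $T$ of $\Gamma$ and a bijection between the cells outside $T$ (the *essential* cells) and $x_1,\dots,x_n$, such that each essential cell is higher than the cells of the path of $T$ joining its endpoints (*well-built*). Let $f_1,\dots,f_k$ be homotopy equivalences of $\Gamma$ fixing the vertices, $f_j$ sending each edge $e$ to a reduced edge-path $v\,e\,u$ with $v,u$ loops made of cells lower than $e$, and let $F_j$ be a lift of $f_j$ to the universal covering $\mathcal T$ of $\Gamma$, equivariant with respect to $\alpha_j\in\mathrm{Aut}(F_n)$ where $[\alpha_j]=\sigma(t_j)$. Let $G=G^\sigma_{n,k}=F_n\rtimes F_k$ with $t_j^{-1}xt_j=\alpha_j(x)$. Let $\mathcal K$ be the universal covering of the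 2-complex obtained from $\Gamma$ by adding a loop $t_j$ at every vertex and every $j$, and 2-cells with boundary $e\,t_j\,f_j(e)^{-1}t_j^{-1}$. Its vertices are the pairs $(g,v)$, $g\in G$, $v$ a vertex of $\Gamma$; the vertices $(g,\cdot)$ span the translate $g\widetilde T$ of a fixed lift of $T$ and have *label* $g$. An element $g\in G$ is identified with the vertex $(g,v)$, for any chosen vertex $v$. The lifts of the cells of $\Gamma$ are the *horizontal* cells; they form disjoint trees (copies of $\mathcal T$) indexed by $F_k$; the lifts of the loops are the *vertical* ($t_j$-)cells. The lift of a 2-cell is a $j$-*square*; its *bottom* is the lift of $e$ and its *top* the lift of $f_j(e)$. The left (right) vertex of a cell is its initial (terminal) one. A geodesic *spans* a set of cells if it crosses an odd number of them. A cell is *exceptional* if its image separates $\Gamma$, and an *EoE-cell* if it is essential or exceptional. **Tops, bottoms.** For a horizontal cell $E$, $E^i_{top}$ is the cell with the same $\Gamma$-label in the top of the $i$-square with bottom $E$; $E^i_{bot}$ is the cell with $(E^i_{bot})^i_{top}=E$. For cells $X,Y$ with the same $\Gamma$-label the *shift* $X\mapsto Y$ is the unique element of $G$ taking $X$ to $Y$.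 $Bot_i(X)$ is the set of bottoms of the $i$-squares with $X$ in their top, and $Bot_i^*(E^i_{top})=Bot_i(E^i_{top})\setminus\{E\}$; put $Bot(E)=\bigcup_iBot_i(E^i_{top})$. For a subgraph $U$ of a horizontal tree, the *crown* of $U$ is the set of essential cells not in $U$ starting (*outgoing*) or ending (*incoming*) at a vertex with the same label as a vertex of $U$; the *completion* $\overline U$ is the smallest tree containing $U$ whose union with the crown of $U$ is a tree. An incoming $X$ and an outgoing $Y$ in the crown are *coherent* if they have the same label $x$, and *twins* if moreover the path from the start of $X$ to the end of $Y$ reads a power of $x$ in $F_n$; such a pair spans a set of cells if the geodesic from the end of $X$ to the start of $Y$ does. $Top(E)$ is the union over $j$ of the translates, by the shift $E^j_{top}\mapsto E$, of the top of the $j$-cylinder over the smallest tree containing $Bot(E)$ (the union of the tops of the $j$-squares with bottom in it); $Top(i,E)$ is its image under the shift $E\mapsto E^i_{top}$; $B(E)$ is the completion of the set of vertices that are, for some $i$, the start of a $t_i$-cell ending in $Top(i,E)$. **Hypotheses.** $E$ is $j$-*topmost* if the image $e$ of $E$ in $\Gamma$ occurs in $f_j(e')$ for no $e'\ne e$. $I\subset\{1,\dots,k\}$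 is an *$E$-tied set* if $E$ is $j$-topmost for $j\notin I$ and, for each geodesic $p$ from an endpoint of $E$ to the frontier of $\overline{Bot(E)}$ not crossing $E$, either $p$ crosses no cell of any $Bot_i(E^i_{top})$ or it crosses a cell of $Bot_i(E^i_{top})$ for every $i\in I$. Assume that $(\{f_j\},\Gamma)$ is *tied* (each EoE-cell $E$ has an $E$-tied set) and *one-sided* (for each EoE-cell $E$, the cells of $Bot(E)\setminus\{E\}$ lie in one side of $E$). **Blocks.** Let $\epsilon=\pm$ and let $I$ be $\emptyset$ or an $E$-tied set. An $\mathcal E$-colour is a $\mathbb Z/2$-valued function on the vertices of a tree which changes exactly across the cells of $\mathcal E$; "positive" means non-zero. The $(\epsilon,I,E)$-*c-top* is $Top(E)$ with the $(\mathbb Z/2)^k$-valued colour whose $i$-coordinate is, for $i\in I$, the $\{E\}$-colour positive on the left (right) vertex of $E$ if $\epsilon=+$ ($-$) and, for $i\notin I$, the $Bot^*_i(E^i_{top})$-colour vanishing on $E$. The $(\epsilon,I,E)$-*c-bottom* is $B(E)$ with the colour whose $i$-coordinate is: if $I=\emptyset$, the $Bot_i^*(E^i_{top})$-colour vanishing on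 $E$; if $I\neq\emptyset$, for $i\in I$ the $Bot_i(E^i_{top})$-colour positive on the left (right) vertex of $E$ if $\epsilon=+$ ($-$), and $0$ for $i\notin I$. The $(\epsilon,I,E)$-*block* with center $E$ consists of the $(\epsilon,I,E)$-c-bottom and of the $(-\epsilon,I,E^i_{top})$-c-tops, $i\in I$, if $I\ne\emptyset$, or the $(\epsilon,\emptyset,E^i_{top})$-c-tops for all $i$ if $I=\emptyset$ (the *white* block); the cells $E^i_{top}$ in question are its *nuclei*. Its *block-lifts* are the shifts $E^l_{bot}\mapsto E$, $l\notin I$. For $i\in I$, if $(X,Y)$ are twins of $B(E)$ spanning $\{E\}$ and $(X',Y')$ twins, with the same label, of $Top(E^i_{top})$ spanning $\{E^i_{top}\}$ (incoming cell first), the shift $Y'\mapsto X$ is a *left stair* and $X'\mapsto Y$ a *right stair*. **Biblocks.** Let $E$ be an EoE-cell and $I_E$ an $E$-tied set. Let $(\gamma,\gamma^{tw})$ be twins (in any order) of $B(E)$ spanning $Bot_i^*(E^i_{top})$ for some $i$ (an *$E$-spanning pair*), such that the geodesic from $E$ to $\gamma^{tw}$ (the *bridge*) spans $Bot^*_{i}(E^{i}_{top})$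 for some $i$; let $h$ be the shift $\gamma\mapsto\gamma^{tw}$ and $Z=hE$. The corresponding *companion* is the $(\epsilon,I_E,Z)$-block with $\epsilon=+$ if and only if the bridge lies on the left side of $Z$. If all the cells of all the $Bot_i^*(E^i_{top})$ are exceptional, the $E$-*biblock* is the white $E$-block; otherwise an $E$-biblock is the completion, in each horizontal tree, of the union of the white $E$-block and a companion whose bridge has greatest height. The colours of the c-tops and c-bottoms are extended, by the same parity rules, to the vertices joined to them by a horizontal path crossing no cell of a c-top or c-bottom of the biblock; this gives the colour of the biblock. A coherent pair $(X,Y)$ is *enabled* if the colours at the end of $X$ and at the start of $Y$ agree. The *mirror pairs* are the pairs $(hX,Y)$ and $(X,hY)$ for $(X,Y)$ an $E$-spanning pair of twins. **Walls.** Fix one of the following two conventions: the *horizontal generators* are the shifts $X\mapsto Y$ at the enabled pairs with non-vanishing colour which are mirror pairs, or (i) pairs of twins, respectively (i') coherent pairs, in the crown of a c-top or c-bottom of the biblock. Fix also one of the following: the *block-stairs* of an $(\epsilon,I,E)$-block are (ii) its left stairs if $\epsilon=+$ and its right ones if $\epsilon=-$, respectively (ii') all its left and right stairs. The *replicative subgroup*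 $\mathfrak R\subset G$ is generated by the horizontal generators and by the block-stairs and block-lifts of the blocks of the biblock. The *elementary cuts* are the nuclei of the blocks and the $t_i$-cells starting at a vertex of the biblock whose colour has positive $i$-coordinate; the *cuts* are their left $\mathfrak R$-translates. The *diagonal wall* of the $E$-biblock is the pair $(VH_L,VH_R)$, where $VH_R$ (resp. $VH_L$) is the set of the vertices of $\mathcal K$ joined to the right vertex of $E$ by an edge-path of the 1-skeleton passing through an even (resp. odd) number of cuts. It *separates* two vertices if one is in $VH_L$ and the other in $VH_R$. The collection of diagonal walls is the set of all these pairs, for all EoE-cells $E$ and all $E$-biblocks. **Proposition.** With each choice of conventions, any two elements of $G^\sigma_{n,k}$ are separated by only finitely many diagonal walls. More precisely, for all $g,g'\in G^\sigma_{n,k}$ and all vertices $v,v'$ of $\Gamma$, only finitely many diagonal walls separate $(g,v)$ from $(g',v')$. -/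

import Mathlib

/-! ### Outer automorphisms -/

instance innerAut_normal (H : Type*) [Group H] :
    (MulAut.conj : H →* MulAut H).range.Normal := by
  refine ⟨?_⟩
  rintro _ ⟨h, rfl⟩ β
  refine ⟨β h, ?_⟩
  ext x
  simp [MulAut.conj_apply]

/-- The group of outer automorphisms `Out(H) = Aut(H) / Inn(H)`. -/
abbrev OutAut (H : Type*) [Group H] : Type _ := MulAut H ⧸ (MulAut.conj : H →* MulAut H).range

/-- The endomorphism of `H₁(H; ℤ)` (the abelianization, written additively) induced by an
automorphism of `H`. -/
noncomputable def homologyMap {H : Type*} [Group H] (β : MulAut H) :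
    AddMonoid.End (Additive (Abelianization H)) :=
  MonoidHom.toAdditive (Abelianization.map β.toMonoidHom)

/-- An outer automorphism is unipotent if the automorphism it induces on `H₁` is unipotent. -/
def IsUnipotentOut {H : Type*} [Group H] (u : OutAut H) : Prop :=
  ∀ β : MulAut H, (QuotientGroup.mk β : OutAut H) = u → IsNilpotent (homologyMap β - 1)

/-! ### Graphs with oriented 1-cells -/

/-- A graph with vertex set `V` and set of 1-cells `C`, each 1-cell being given with its
positive orientation.  An oriented edge is a pair `(c, b)`, with `b = true` for the positive
orientation. -/
structure OGraph (V C : Type*) where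
  src : C → V
  tgt : C → V

namespace OGraph

variable {V C : Type*} (Γ : OGraph V C)

def start (s : C × Bool) : V := if s.2 then Γ.src s.1 else Γ.tgt s.1

def finish (s : C × Bool) : V := if s.2 then Γ.tgt s.1 else Γ.src s.1

/-- `IsPath a p b`: the list `p` of oriented edges is an edge-path from `a` to `b`. It is
reduced (a geodesic, in a tree) when moreover `FreeGroup.IsReduced p`, i.e. when no edge is
followed by its inverse. -/
def IsPath : V → List (C × Bool) → V → Prop
  | a, [], b => a = b
  | a, s :: p, b => Γ.start s = a ∧ IsPath (Γ.finish s) p b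

open scoped Classical in
/-- The number of times an edge-path passes through the 1-cells of `S`. -/
noncomputable def crossings (S : Set C) (p : List (C × Bool)) : ℕ :=
  p.countP (fun s => decide (s.1 ∈ S))

/-- There is a geodesic from `a` to `b` crossing an odd number of cells of `S`. -/
def OddCross (S : Set C) (a b : V) : Prop :=
  ∃ p, Γ.IsPath a p b ∧ FreeGroup.IsReduced p ∧ Odd (crossings S p)

/-- There is a geodesic from `a` to `b` crossing an even number of cells of `S`. -/
def EvenCross (S : Set C) (a b : V) : Prop :=
  ∃ p, Γ.IsPath a p b ∧ FreeGroup.IsReduced p ∧ Even (crossings S p)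

/-- Subgraphs of `Γ`. -/
structure Sub where
  verts : Set V
  cells : Set C
  src_mem : ∀ c ∈ cells, Γ.src c ∈ verts
  tgt_mem : ∀ c ∈ cells, Γ.tgt c ∈ verts

variable {Γ}

namespace Sub

def IsSub (U W : Γ.Sub) : Prop := U.verts ⊆ W.verts ∧ U.cells ⊆ W.cells

/-- Connectedness; a connected subgraph of a forest is the same thing as a subtree. -/
def Connected (U : Γ.Sub) : Prop :=
  ∀ a ∈ U.verts, ∀ b ∈ U.verts, ∃ p, Γ.IsPath a p b ∧ ∀ s ∈ p, s.1 ∈ U.cells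

/-- The subgraph consisting of the vertices `vs`, the cells `cs` and the endpoints of `cs`. -/
def span (Γ : OGraph V C) (vs : Set V) (cs : Set C) : Γ.Sub where
  verts := vs ∪ (Γ.src '' cs ∪ Γ.tgt '' cs)
  cells := cs
  src_mem c hc := Or.inr (Or.inl ⟨c, hc, rfl⟩)
  tgt_mem c hc := Or.inr (Or.inr ⟨c, hc, rfl⟩)

def sUnion (F : Set Γ.Sub) : Γ.Sub where
  verts := {v | ∃ U ∈ F, v ∈ U.verts}
  cells := {c | ∃ U ∈ F, c ∈ U.cells}
  src_mem := by rintro c ⟨U, hU, hc⟩; exact ⟨U, hU, U.src_mem c hc⟩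
  tgt_mem := by rintro c ⟨U, hU, hc⟩; exact ⟨U, hU, U.tgt_mem c hc⟩

/-- The intersection of all the subgraphs satisfying `P` (the smallest one, if there is one). -/
def smallest (P : Γ.Sub → Prop) : Γ.Sub where
  verts := {v | ∀ U, P U → v ∈ U.verts}
  cells := {c | ∀ U, P U → c ∈ U.cells}
  src_mem c hc U hU := U.src_mem c (hc U hU)
  tgt_mem c hc U hU := U.tgt_mem c (hc U hU)

/-- The smallest tree containing `U`. -/
def hull (U : Γ.Sub) : Γ.Sub := smallest fun S => S.Connected ∧ U.IsSub S

/-- The frontier of a subgraph: its vertices which are incident to a cell outside it. -/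
def frontier (U : Γ.Sub) : Set V :=
  {v | v ∈ U.verts ∧ ∃ c, c ∉ U.cells ∧ (Γ.src c = v ∨ Γ.tgt c = v)}

end Sub

end OGraph

/-! ### Filtered graphs and BFH-representatives -/

/-- A filtered graph of `F_n` with a maximal tree.  The 1-cells are `e_0 < e_1 < ⋯ < e_{r-1}`,
in the order of the filtration: the `i`-th stage of the filtration is the union of the first `i`
cells.  The cells `e` with `gen e = none` form the maximal tree, and `gen e = some i` means that
`e` is essential, with `F_n`-label `x_i`. -/
structure FilteredGraph (n r : ℕ) (V : Type*) extends OGraph V (Fin r) where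
  nonempty : Nonempty V
  gen : Fin r → Option (Fin n)
  gen_bij : ∀ i, ∃! e, gen e = some i
  maxTree : ∀ u v, ∃! p, toOGraph.IsPath u p v ∧ FreeGroup.IsReduced p ∧ ∀ s ∈ p, gen s.1 = none

namespace FilteredGraph

variable {n r : ℕ} {V : Type*} (Γ : FilteredGraph n r V)

def Essential (e : Fin r) : Prop := Γ.gen e ≠ none

/-- The cell `e` separates the graph: its endpoints cannot be joined without crossing it. -/
def Exceptional (e : Fin r) : Prop :=
  ¬ ∃ p, Γ.IsPath (Γ.src e) p (Γ.tgt e) ∧ ∀ s ∈ p, s.1 ≠ e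

def IsEoE (e : Fin r) : Prop := Γ.Essential e ∨ Γ.Exceptional e

/-- The element of `F_n` read by a positively oriented edge. -/
def label (e : Fin r) : FreeGroup (Fin n) :=
  match Γ.gen e with
  | some i => FreeGroup.of i
  | none => 1

/-- The element of `F_n` read by an edge-path. -/
def read (p : List (Fin r × Bool)) : FreeGroup (Fin n) :=
  (p.map fun s => if s.2 then Γ.label s.1 else (Γ.label s.1)⁻¹).prod

/-- Each essential cell is higher than the other cells of the simple loop with the same
`F_n`-label, i.e. than the cells of the path joining its endpoints in the maximal tree. -/
def WellBuilt : Prop :=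
  ∀ e, Γ.Essential e → ∀ p, Γ.IsPath (Γ.tgt e) p (Γ.src e) → FreeGroup.IsReduced p →
    (∀ s ∈ p, Γ.gen s.1 = none) → ∀ s ∈ p, s.1 < e

end FilteredGraph

/-- A well-built BFH-representative: a family of `k` reduced filtered homotopy equivalences `f_j`
of a well-built filtered graph of `F_n`, together with lifts `F_j` to its universal covering.

The map `f_j` fixes the vertices and sends the edge `e` to the reduced edge-path
`pre j e · e · post j e`, where `pre j e` and `post j e` are loops made of lower cells.

The universal covering of `Γ` has vertex set `F_n × V` and set of 1-cells `F_n × {cells of Γ}`,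
the cell `(x, e)` going from `(x, src e)` to `(x · label e, tgt e)`; the copies of the maximal tree
are the `{x} × V`.  The lift `F_j` is the `α j`-equivariant map with `F_j (1, v) = (c j v, v)`, and
`lift_eq` says that the image of the cell `(1, e)` ends at the right place. -/
structure BFHRep (n k r : ℕ) (V : Type*) extends FilteredGraph n r V where
  wellBuilt : toFilteredGraph.WellBuilt
  pre : Fin k → Fin r → List (Fin r × Bool)
  post : Fin k → Fin r → List (Fin r × Bool)
  pre_loop : ∀ j e, toOGraph.IsPath (src e) (pre j e) (src e)
  post_loop : ∀ j e, toOGraph.IsPath (tgt e) (post j e) (tgt e)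
  pre_lt : ∀ j e, ∀ s ∈ pre j e, s.1 < e
  post_lt : ∀ j e, ∀ s ∈ post j e, s.1 < e
  reduced : ∀ j e, FreeGroup.IsReduced (pre j e ++ (e, true) :: post j e)
  α : Fin k → MulAut (FreeGroup (Fin n))
  c : Fin k → V → FreeGroup (Fin n)
  lift_eq : ∀ j e,
    c j (src e) * toFilteredGraph.read (pre j e ++ (e, true) :: post j e) =
      α j (toFilteredGraph.label e) * c j (tgt e)

namespace BFHRep

variable {n k r : ℕ} {V : Type*} (R : BFHRep n k r V)

/-- The image of the edge `e` under `f_j`. -/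
def img (j : Fin k) (e : Fin r) : List (Fin r × Bool) := R.pre j e ++ (e, true) :: R.post j e

/-- The cell `e` is `j`-topmost: it appears in the image under `f_j` of no other cell. -/
def Topmost (j : Fin k) (e : Fin r) : Prop := ∀ e', e' ≠ e → ∀ s ∈ R.img j e', s.1 ≠ e

/-! ### The suspension group and the mapping-cylinder -/

def action : FreeGroup (Fin k) →* MulAut (FreeGroup (Fin n)) :=
  FreeGroup.lift fun j => (R.α j)⁻¹

/-- The suspension `F_n ⋊ F_k`, in which `t_j⁻¹ x t_j = α_j(x)` for `x ∈ F_n`: this is what is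
read in the boundary `e t_j f_j(e)⁻¹ t_j⁻¹` of the 2-cells of the suspension of the graph. -/
abbrev G : Type := FreeGroup (Fin n) ⋊[R.action] FreeGroup (Fin k)

def hz (x : FreeGroup (Fin n)) : R.G := SemidirectProduct.inl x

def t (j : Fin k) : R.G := SemidirectProduct.inr (FreeGroup.of j)

/-- The vertices of the mapping-cylinder (the universal covering of the suspension of the graph).
The lift `g · T` of the maximal tree `T` has vertices `(g, v)`, with `v` a vertex of `T`. -/
abbrev Vtx : Type _ := R.G × V

/-- The horizontal 1-cells of the mapping-cylinder. -/
abbrev HCell : Type := R.G × Fin r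

/-- The vertical 1-cells of the mapping-cylinder: `(g, v, j)` is the `t_j`-cell starting
at `(g, v)`. -/
abbrev VCell : Type _ := R.G × V × Fin k

/-- The end of the `t_j`-cell starting at a given vertex. -/
def up (j : Fin k) (v : R.Vtx) : R.Vtx := (v.1 * R.t j * R.hz (R.c j v.2), v.2)

/-- The union of the horizontal trees. The horizontal tree of the mapping-cylinder over `w ∈ F_k`
consists of the cells whose first component has image `w` in `F_k`. -/
def hor : OGraph R.Vtx R.HCell where
  src E := (E.1, R.src E.2)
  tgt E := (E.1 * R.hz (R.label E.2), R.tgt E.2)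

/-- The 1-skeleton of the mapping-cylinder. -/
def skeleton : OGraph R.Vtx (R.HCell ⊕ R.VCell) where
  src := Sum.elim R.hor.src fun d => (d.1, d.2.1)
  tgt := Sum.elim R.hor.tgt fun d => R.up d.2.2 (d.1, d.2.1)

/-- The horizontal 1-cells crossed by the horizontal edge-path which starts in the copy `g · T` of
the maximal tree and reads a given edge-path of the graph. -/
def liftCells : R.G → List (Fin r × Bool) → List R.HCell
  | _, [] => []
  | g, (e, true) :: p => (g, e) :: liftCells (g * R.hz (R.label e)) p
  | g, (e, false) :: p =>
      (g * (R.hz (R.label e))⁻¹, e) :: liftCells (g * (R.hz (R.label e))⁻¹) p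

/-- The cells in the top of the `j`-square with bottom `E`. -/
def squareTop (j : Fin k) (E : R.HCell) : List R.HCell :=
  R.liftCells (R.up j (R.hor.src E)).1 (R.img j E.2)

/-- The element by which one right-multiplies the position of a cell labelled `e` to get the cell
with the same label in the top of the `j`-square above it. -/
def climb (j : Fin k) (e : Fin r) : R.G :=
  R.t j * R.hz (R.c j (R.src e)) * R.hz (R.read (R.pre j e))

/-- The cell `E^j_top` with the same label as `E` in the top of the `j`-square with bottom `E`. -/
def topCell (j : Fin k) (E : R.HCell) : R.HCell := (E.1 * R.climb j E.2, E.2)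

/-- The cell `E^j_bot` with the same label as `E` which is the bottom of a `j`-square having `E`
in its top: it is determined by `(E^j_bot)^j_top = E`. -/
def botCell (j : Fin k) (E : R.HCell) : R.HCell := (E.1 * (R.climb j E.2)⁻¹, E.2)

theorem topCell_mem_squareTop (j : Fin k) (E : R.HCell) : R.topCell j E ∈ R.squareTop j E := by
  have key : ∀ (p q : List (Fin r × Bool)) (g : R.G) (e : Fin r),
      (g * R.hz (R.read p), e) ∈ R.liftCells g (p ++ (e, true) :: q) := by
    intro p q
    induction p with
    | nil => intro g e; simp [liftCells, FilteredGraph.read, hz]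
    | cons s p ih =>
      rintro g e
      obtain ⟨a, b⟩ := s
      cases b
      · have h := ih (g * (R.hz (R.label a))⁻¹) e
        simp only [List.cons_append, liftCells, List.mem_cons]
        right
        convert h using 2
        simp [FilteredGraph.read, hz, mul_assoc]
      · have h := ih (g * R.hz (R.label a)) e
        simp only [List.cons_append, liftCells, List.mem_cons]
        right
        convert h using 2
        simp [FilteredGraph.read, hz, mul_assoc]
  have h := key (R.pre j E.2) (R.post j E.2) (R.up j (R.hor.src E)).1 E.2
  simpa [topCell, climb, squareTop, img, up, hor, mul_assoc] using h

/-- For two cells `X`, `Y` with the same label, the element of the group which sends `X`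
to `Y` by left-translation. -/
def shift (X Y : R.HCell) : R.G := Y.1 * X.1⁻¹

def moveCell (g : R.G) (X : R.HCell) : R.HCell := (g * X.1, X.2)

def moveVtx (g : R.G) (v : R.Vtx) : R.Vtx := (g * v.1, v.2)

/-- Left-translation of horizontal subgraphs. -/
def moveSub (g : R.G) (U : R.hor.Sub) : R.hor.Sub where
  verts := R.moveVtx g '' U.verts
  cells := R.moveCell g '' U.cells
  src_mem := by rintro _ ⟨X, hX, rfl⟩; exact ⟨_, U.src_mem X hX, rfl⟩
  tgt_mem := by
    rintro _ ⟨X, hX, rfl⟩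
    exact ⟨_, U.tgt_mem X hX, by simp [moveVtx, moveCell, hor, mul_assoc]⟩

/-- The intersection of a horizontal subgraph with the horizontal tree over `w`. -/
def level (w : FreeGroup (Fin k)) (U : R.hor.Sub) : R.hor.Sub where
  verts := {v | v ∈ U.verts ∧ v.1.right = w}
  cells := {X | X ∈ U.cells ∧ X.1.right = w}
  src_mem X hX := ⟨U.src_mem X hX.1, hX.2⟩
  tgt_mem X hX := ⟨U.tgt_mem X hX.1, by simpa [hor, hz] using hX.2⟩

/-- The initial (`ε = true`) or terminal vertex of a cell, i.e. its left or right vertex. -/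
def pole (ε : Bool) (E : R.HCell) : R.Vtx := if ε then R.hor.src E else R.hor.tgt E

/-! ### Crowns, completions, twins -/

/-- The essential cell `X` is outgoing at `U`: it starts at (a vertex with the same label as)
a vertex of `U`, and is not in `U`. -/
def Outgoing (U : R.hor.Sub) (X : R.HCell) : Prop :=
  R.Essential X.2 ∧ X ∉ U.cells ∧ ∃ v ∈ U.verts, v.1 = (R.hor.src X).1

/-- The essential cell `X` is incoming at `U`. -/
def Incoming (U : R.hor.Sub) (X : R.HCell) : Prop :=
  R.Essential X.2 ∧ X ∉ U.cells ∧ ∃ v ∈ U.verts, v.1 = (R.hor.tgt X).1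

def crown (U : R.hor.Sub) : Set R.HCell := {X | R.Incoming U X ∨ R.Outgoing U X}

/-- The smallest tree containing `U` whose union with the crown of `U` is also a tree. -/
def completion (U : R.hor.Sub) : R.hor.Sub :=
  OGraph.Sub.smallest fun S => S.Connected ∧ U.IsSub S ∧
    (OGraph.Sub.sUnion {S, OGraph.Sub.span R.hor ∅ (R.crown U)}).Connected

/-- `X` (incoming) and `Y` (outgoing) form a coherent pair in the crown of `U`. -/
def Coherent (U : R.hor.Sub) (X Y : R.HCell) : Prop :=
  R.Incoming U X ∧ R.Outgoing U Y ∧ X.2 = Y.2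

/-- A coherent pair is a pair of twins if the path from the initial vertex of the incoming cell to
the terminal vertex of the outgoing one reads a power of their label. -/
def Twins (U : R.hor.Sub) (X Y : R.HCell) : Prop :=
  R.Coherent U X Y ∧
    ∃ m : ℤ, (R.hor.src X).1⁻¹ * (R.hor.tgt Y).1 = R.hz (R.label X.2) ^ m

/-- The pair (`X` incoming, `Y` outgoing) spans the set of cells `S`: the geodesic joining `X`
to `Y` crosses an odd number of cells of `S`. -/
def PairSpans (S : Set R.HCell) (X Y : R.HCell) : Prop :=
  R.hor.OddCross S (R.hor.tgt X) (R.hor.src Y)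

/-! ### Tops and bottoms -/

/-- `Bot_i(X)`: the bottoms of the `i`-squares which contain `X` in their top. -/
def Bot (i : Fin k) (X : R.HCell) : Set R.HCell := {Y | X ∈ R.squareTop i Y}

/-- `Bot_i(E^i_top)`, the set of the cells `E'` such that `F_i(E')` contains `E^i_top`. -/
def botTop (i : Fin k) (E : R.HCell) : Set R.HCell := R.Bot i (R.topCell i E)

/-- `Bot_i^*(E^i_top)`: the previous set with `E` itself removed. -/
def botStar (i : Fin k) (E : R.HCell) : Set R.HCell := R.botTop i E \ {E}

/-- The union of the cells of `Bot_i(E^i_top)`, over all `i`. -/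
def botAll (E : R.HCell) : R.hor.Sub := OGraph.Sub.span R.hor ∅ (⋃ i, R.botTop i E)

/-- The top of the `j`-cylinder over `U`, i.e. the image of `U` in the upper horizontal tree. -/
def cylTop (j : Fin k) (U : R.hor.Sub) : R.hor.Sub :=
  OGraph.Sub.span R.hor (R.up j '' U.verts) {X | ∃ Y ∈ U.cells, X ∈ R.squareTop j Y}

/-- The `E`-top: the union of the translates, by the elements taking `E^j_top` to `E`, of the top
of the `j`-cylinder over the smallest tree containing all the `Bot_i(E^i_top)`. -/
def Top (E : R.HCell) : R.hor.Sub :=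
  OGraph.Sub.sUnion
    {U | ∃ j, U = R.moveSub (R.shift (R.topCell j E) E) (R.cylTop j (R.botAll E).hull)}

/-- `Top(i, E)`, the translate of the `E`-top by the element taking `E` to `E^i_top`. -/
def TopAt (i : Fin k) (E : R.HCell) : R.hor.Sub := R.moveSub (R.shift E (R.topCell i E)) (R.Top E)

/-- The `E`-bottom: the completion of the set of all the vertices lying, for some `i`, at the
bottom of a `t_i`-cell which ends in `Top(i, E)`. -/
def Bottom (E : R.HCell) : R.hor.Sub :=
  R.completion (OGraph.Sub.span R.hor {v | ∃ i, R.up i v ∈ (R.TopAt i E).verts} ∅)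

/-! ### Tied and one-sided representatives -/

/-- `I` is an `E`-tied-set: `E` is `j`-topmost for `j ∉ I` and, for every geodesic `p` from `E`
to the frontier of the completion of the union of the `Bot_i(E^i_top)`, either no `F_i(p)`
contains `E^i_top`, or `F_i(p)` contains `E^i_top` for each `i ∈ I`. -/
def IsTiedSet (E : R.HCell) (I : Set (Fin k)) : Prop :=
  (∀ j, j ∉ I → R.Topmost j E.2) ∧
  ∀ ε b p, b ∈ (R.completion (R.botAll E)).frontier → R.hor.IsPath (R.pole ε E) p b →
    FreeGroup.IsReduced p → (∀ s ∈ p, s.1 ≠ E) →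
    (∀ i, ∀ s ∈ p, s.1 ∉ R.botTop i E) ∨ (∀ i ∈ I, ∃ s ∈ p, s.1 ∈ R.botTop i E)

def IsTied : Prop := ∀ E : R.HCell, R.IsEoE E.2 → ∃ I, R.IsTiedSet E I

/-- For every EoE-cell `E`, the cells `X ≠ E` of the sets `Bot_i(E^i_top)` all lie in a single side
of `E`. -/
def IsOneSided : Prop :=
  ∀ E : R.HCell, R.IsEoE E.2 →
    ∃ ε, ∀ i, ∀ X ∈ R.botStar i E, R.hor.EvenCross {E} (R.pole ε E) (R.hor.src X)

/-! ### Coloured trees and blocks -/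

/-- A horizontal tree `dom` with a `k`-colour: `pos v i` says that the `i`-coordinate, in `ℤ/2`, of
the colour of the vertex `v` is non-zero ("positive"). Every colour below is given by a parity
rule which makes sense at all the vertices of the horizontal tree containing `dom`. -/
structure ColoredTree where
  dom : R.hor.Sub
  pos : R.Vtx → Fin k → Prop

/-- The `(ε, I, E)`-c-top. -/
def cTop (ε : Bool) (I : Set (Fin k)) (E : R.HCell) : R.ColoredTree where
  dom := R.Top E
  pos v i := (i ∈ I ∧ R.hor.EvenCross {E} (R.pole ε E) v) ∨
    (i ∉ I ∧ R.hor.OddCross (R.botStar i E) (R.hor.src E) v)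

/-- The `(ε, I, E)`-c-bottom. -/
def cBottom (ε : Bool) (I : Set (Fin k)) (E : R.HCell) : R.ColoredTree where
  dom := R.Bottom E
  pos v i := (I = ∅ ∧ R.hor.OddCross (R.botStar i E) (R.hor.src E) v) ∨
    (i ∈ I ∧ R.hor.EvenCross (R.botTop i E) (R.pole ε E) v)

/-- The nuclei of the `(ε, I, E)`-block. -/
def blockNuclei (I : Set (Fin k)) (E : R.HCell) : Set R.HCell :=
  {N | ∃ i, (I = ∅ ∨ i ∈ I) ∧ N = R.topCell i E}

/-- The c-bottom and the c-tops which compose the `(ε, I, E)`-block. -/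
def block (ε : Bool) (I : Set (Fin k)) (E : R.HCell) : Set R.ColoredTree :=
  {P | P = R.cBottom ε I E ∨ (I = ∅ ∧ ∃ l, P = R.cTop ε ∅ (R.topCell l E)) ∨
    ∃ i ∈ I, P = R.cTop (!ε) I (R.topCell i E)}

/-- The block-lifts of the `(ε, I, E)`-block. -/
def blockLifts (I : Set (Fin k)) (E : R.HCell) : Set R.G :=
  {g | ∃ l, l ∉ I ∧ g = R.shift (R.botCell l E) E}

/-- Left (`δ = true`) and right (`δ = false`) stairs of the `(ε, I, E)`-block: `(X, Y)` is a pair of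
twins of the c-bottom spanning `E`, `(X', Y')` is a pair of twins of the c-top at `E^i_top`
spanning `E^i_top`, and the left stair sends `Y'` to `X` while the right one sends `X'` to `Y`. -/
def blockStairs (δ : Bool) (I : Set (Fin k)) (E : R.HCell) : Set R.G :=
  {g | ∃ i ∈ I, ∃ X Y X' Y',
    R.Twins (R.Bottom E) X Y ∧ R.PairSpans {E} X Y ∧
    R.Twins (R.Top (R.topCell i E)) X' Y' ∧ R.PairSpans {R.topCell i E} X' Y' ∧
    X'.2 = X.2 ∧ g = if δ then R.shift Y' X else R.shift X' Y}

/-! ### Companions and biblocks -/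

/-- A companion of the white `E`-block is given by a pair of twins of the `E`-bottom (`X` incoming,
`Y` outgoing), the choice of the one of the two which is the bridge, and a sign. -/
structure Companion where
  X : R.HCell
  Y : R.HCell
  bridgeIsX : Bool
  ε : Bool

variable {R} in
def Companion.bridge (C : R.Companion) : R.HCell := if C.bridgeIsX then C.X else C.Y

variable {R} in
/-- The shift taking the twin of the bridge to the bridge. -/
def Companion.h (C : R.Companion) : R.G :=
  if C.bridgeIsX then R.shift C.Y C.X else R.shift C.X C.Y

variable {R} in
/-- The translate `Z` of `E`, which is the center of the companion block. -/
def Companion.Z (C : R.Companion) (E : R.HCell) : R.HCell := R.moveCell C.h E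

variable {R} in
/-- The endpoint of the bridge on the side of `E`. -/
def Companion.near (C : R.Companion) : R.Vtx :=
  if C.bridgeIsX then R.hor.tgt C.X else R.hor.src C.Y

variable {R} in
/-- The endpoint of the bridge on the side of `Z`. -/
def Companion.far (C : R.Companion) : R.Vtx :=
  if C.bridgeIsX then R.hor.src C.X else R.hor.tgt C.Y

/-- `(X, Y)` is an `E`-spanning pair of twins of the `E`-bottom. -/
def SpanningPair (E X Y : R.HCell) : Prop :=
  R.Twins (R.Bottom E) X Y ∧ ∃ i, R.PairSpans (R.botStar i E) X Y

/-- `C` gives a `Z`-companion of the white `E`-block: the twins form an `E`-spanning pair, the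
geodesic from `E` to the bridge spans `Bot_i^*(E^i_top)` for some `i`, and the vertex of `Z` at
which the colour of the c-bottom is positive is the one on the same side of `Z` as the bridge. -/
def IsCompanion (E : R.HCell) (C : R.Companion) : Prop :=
  R.SpanningPair E C.X C.Y ∧
  (∃ i, R.hor.OddCross (R.botStar i E) (R.hor.src E) C.near) ∧
  (C.ε = true ↔ R.hor.EvenCross {C.Z E} (R.hor.src (C.Z E)) C.far)

/-- The data of an `E`-biblock: the center `E`, the tied-set `I` and possibly a companion. -/
structure Biblock where
  E : R.HCell
  I : Set (Fin k)
  comp : Option R.Companion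

/-- If some `Bot_i^*(E^i_top)` contains a non-exceptional cell, the biblock consists of the white
`E`-block and of a companion whose bridge has greatest height, otherwise of the white block
only. -/
def IsBiblock (b : R.Biblock) : Prop :=
  R.IsEoE b.E.2 ∧ R.IsTiedSet b.E b.I ∧
  match b.comp with
  | none => ∀ i, ∀ X ∈ R.botStar i b.E, R.Exceptional X.2
  | some C => (∃ i, ∃ X ∈ R.botStar i b.E, ¬ R.Exceptional X.2) ∧ R.IsCompanion b.E C ∧
      ∀ C', R.IsCompanion b.E C' → C'.bridge.2 ≤ C.bridge.2

namespace Biblock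

variable {R} (b : R.Biblock)

/-- The triples `(ε, I, center)` of the white block and of the companion block, if any. -/
def blocks : Set (Bool × Set (Fin k) × R.HCell) :=
  {q | q = (true, ∅, b.E) ∨ ∃ C, b.comp = some C ∧ q = (C.ε, b.I, C.Z b.E)}

/-- All the c-bottoms and c-tops of the biblock. -/
def parts : Set R.ColoredTree := {P | ∃ q ∈ b.blocks, P ∈ R.block q.1 q.2.1 q.2.2}

/-- The union of the c-bottoms and c-tops. -/
def union : R.hor.Sub := OGraph.Sub.sUnion {U | ∃ P ∈ b.parts, U = P.dom}

/-- The vertices of the biblock. With a companion, the biblock is the completion (in each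
horizontal tree) of the union of the two blocks. -/
def verts : Set R.Vtx :=
  match b.comp with
  | none => b.union.verts
  | some _ => {v | v ∈ (R.completion (R.level v.1.right b.union)).verts}

/-- The admissible colour of the biblock: the set of the coordinates which are positive at `v`. The
colour of each c-top or c-bottom is extended to the vertices which are joined to it without
crossing a cell of a c-top or c-bottom. -/
def colour (v : R.Vtx) : Set (Fin k) :=
  {i | ∃ P ∈ b.parts, P.pos v i ∧
    ∃ a ∈ P.dom.verts, ∃ p, R.hor.IsPath a p v ∧ ∀ s ∈ p, s.1 ∉ b.union.cells}

/-- The pair (`X` incoming, `Y` outgoing) is enabled, with non-vanishing admissible colour. -/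
def Enabled (X Y : R.HCell) : Prop :=
  b.colour (R.hor.tgt X) = b.colour (R.hor.src Y) ∧ (b.colour (R.hor.tgt X)).Nonempty

/-- The coherent pairs giving the mirrors: for an `E`-spanning pair of twins `(X, Y)` of the white
block and its translate `(h X, h Y)` in the companion block, the pairs `(h X, Y)`
and `(X, h Y)`. -/
def MirrorPair (P Q : R.HCell) : Prop :=
  ∃ C, b.comp = some C ∧ ∃ X Y, R.SpanningPair b.E X Y ∧
    ((P = R.moveCell C.h X ∧ Q = Y) ∨ (P = X ∧ Q = R.moveCell C.h Y))

end Biblock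

end BFHRep

/-! ### Replicative subgroups, cuts and walls -/

/-- Two conventions left open in the construction. `twinShifts`: the shifts of a c-top or c-bottom
are those at pairs of twins in its crown (`true`) or those at all coherent pairs (`false`).
`matchingStairs`: the block-stairs of an `(ε, I, E)`-block are the left ones if `ε = +` and the
right ones if `ε = -` (`true`), or both the left and the right ones (`false`). -/
structure WallConvention where
  twinShifts : Bool
  matchingStairs : Bool

namespace BFHRep

namespace Biblock

variable {n k r : ℕ} {V : Type*} {R : BFHRep n k r V} (b : R.Biblock) (κ : WallConvention)

/-- The `E`-horizontal generators: the enabled shifts of the biblock (mirrors included) with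
non-vanishing admissible colour. -/
def horizontalGenerators : Set R.G :=
  {g | ∃ X Y, b.Enabled X Y ∧ g = R.shift X Y ∧
    ((∃ P ∈ b.parts, R.Coherent P.dom X Y ∧ (κ.twinShifts = true → R.Twins P.dom X Y)) ∨
      b.MirrorPair X Y)}

/-- The block-stairs of the biblock. -/
def stairs : Set R.G :=
  {g | ∃ q ∈ b.blocks, ∃ δ, (κ.matchingStairs = true → δ = q.1) ∧
    g ∈ R.blockStairs δ q.2.1 q.2.2}

/-- The block-lifts of the biblock. -/
def lifts : Set R.G := {g | ∃ q ∈ b.blocks, g ∈ R.blockLifts q.2.1 q.2.2}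

/-- The `E`-diagonal generators. -/
def diagonalGenerators : Set R.G := b.horizontalGenerators κ ∪ b.stairs κ

/-- The `E`-replicative subgroup. -/
def replicative : Subgroup R.G := Subgroup.closure (b.lifts ∪ b.diagonalGenerators κ)

/-- The elementary `E`-cuts: the nuclei of the biblock, and the `t_i`-cells starting at a vertex of
the biblock where the `i`-coordinate of the admissible colour is positive. -/
def elementaryCuts : Set (R.HCell ⊕ R.VCell) :=
  {c | (∃ q ∈ b.blocks, ∃ N ∈ R.blockNuclei q.2.1 q.2.2, c = Sum.inl N) ∨
    ∃ v ∈ b.verts, ∃ i ∈ b.colour v, c = Sum.inr (v.1, v.2, i)}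

/-- The `E`-cuts: the left-translates of the elementary ones by the replicative subgroup. -/
def cuts : Set (R.HCell ⊕ R.VCell) :=
  {c | ∃ g ∈ b.replicative κ, ∃ d ∈ b.elementaryCuts,
    c = Sum.map (fun X => (g * X.1, X.2)) (fun X => (g * X.1, X.2)) d}

/-- The right side of the wall: the vertices joined to the right vertex of `E` by an edge-path
passing through an even number of cuts. -/
def rightSide : Set R.Vtx :=
  {v | ∃ p, R.skeleton.IsPath (R.hor.tgt b.E) p v ∧ Even (OGraph.crossings (b.cuts κ) p)}

/-- The left side of the wall: the same with an odd number of cuts. -/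
def leftSide : Set R.Vtx :=
  {v | ∃ p, R.skeleton.IsPath (R.hor.tgt b.E) p v ∧ Odd (OGraph.crossings (b.cuts κ) p)}

end Biblock

variable {n k r : ℕ} {V : Type*} (R : BFHRep n k r V)

/-- The collection of all the diagonal walls, for all EoE-cells `E` and all `E`-biblocks. A wall is
the pair of its sides, so walls with the same sides are identified. -/
def diagonalWalls (κ : WallConvention) : Set (Set R.Vtx × Set R.Vtx) :=
  {W | ∃ b : R.Biblock, R.IsBiblock b ∧ W = (b.leftSide κ, b.rightSide κ)}

end BFHRep

/-- `x` and `y` lie in distinct sides of the wall `W`. -/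
def Separates {X : Type*} (W : Set X × Set X) (x y : X) : Prop :=
  (x ∈ W.1 ∧ y ∈ W.2) ∨ (x ∈ W.2 ∧ y ∈ W.1)

/-! The 1-skeleton carries a left action of `G`, free on 1-cells, and every ingredient of a wall
(tops, bottoms, blocks, colours, replicative subgroup, cuts) is built equivariantly. A wall
separating two vertices is then controlled by its set of cuts, and the claim becomes local
finiteness: each 1-cell lies in only finitely many cut sets.

Local finiteness (`finite_cuts_through`) has three sources. First, up to translation there are
finitely many biblocks: the center can be moved to one of the cells `(1, e)`, the tied set is a
subset of `Fin k`, and the twins giving a companion lie in the crown of the bottom, which is finite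
(`finite_representatives`). Second, each biblock has finitely many elementary cuts, because hulls,
completions, tops and bottoms of finite subgraphs of a horizontal tree are finite
(`elementaryCuts_finite`). Third, the replicative subgroup, possibly infinite, does no harm. If `d`
is a cut of the translate by `g` of a representative, then `d` is the translate by `g * γ` of one of
its elementary cuts `d'`, with `γ` in the replicative subgroup. The cut set of the representative is
stable under `γ`, so the cut set of the translate depends only on `g * γ`, and by freeness `d` and
`d'` determine this product.

From cuts to walls (`wall_cases`): seen from a vertex `x` on one of its sides, a wall is determined,
up to the order of its sides, by its cut set. Fix a path from `x` to `y`. If a wall separating them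
has no cut on this path, some loop at `x` crosses an odd number of cuts, and both sides are the
whole component of `x`; this is a single degenerate pair. All other separating walls have a cut on
the path, which has finitely many cells. -/

/-! ### Edge-paths and parity of crossings -/

namespace OGraph

variable {V C : Type*} (Γ : OGraph V C)

@[simp] theorem isPath_nil {a b : V} : Γ.IsPath a [] b ↔ a = b := Iff.rfl

@[simp] theorem isPath_cons {a b : V} {s : C × Bool} {p : List (C × Bool)} :
    Γ.IsPath a (s :: p) b ↔ Γ.start s = a ∧ Γ.IsPath (Γ.finish s) p b := Iff.rfl

variable {Γ}

theorem IsPath.append {a b c : V} {p q : List (C × Bool)} (hp : Γ.IsPath a p b)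
    (hq : Γ.IsPath b q c) : Γ.IsPath a (p ++ q) c := by
  induction p generalizing a with
  | nil => obtain rfl : a = b := hp; exact hq
  | cons s p ih => exact ⟨hp.1, ih hp.2⟩

theorem IsPath.reverse {a b : V} {p : List (C × Bool)} (hp : Γ.IsPath a p b) :
    Γ.IsPath b (FreeGroup.invRev p) a := by
  induction p generalizing a with
  | nil => exact Eq.symm hp
  | cons s p ih =>
    have h : Γ.IsPath (Γ.finish s) [(s.1, !s.2)] a := by
      obtain ⟨c, b⟩ := s
      have := hp.1
      cases b <;> simpa [start, finish] using this
    simpa [FreeGroup.invRev] using (ih hp.2).append h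

theorem mem_invRev {p : List (C × Bool)} {s : C × Bool} (hs : s ∈ FreeGroup.invRev p) :
    ∃ s' ∈ p, s'.1 = s.1 := by
  simp only [FreeGroup.invRev, List.mem_reverse, List.mem_map] at hs
  obtain ⟨s', h, rfl⟩ := hs
  exact ⟨s', h, rfl⟩

theorem crossings_append (S : Set C) (p q : List (C × Bool)) :
    crossings S (p ++ q) = crossings S p + crossings S q := by
  simp [crossings]

theorem crossings_invRev (S : Set C) (p : List (C × Bool)) :
    crossings S (FreeGroup.invRev p) = crossings S p := by
  simp [crossings, FreeGroup.invRev, List.countP_map, Function.comp_def]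

theorem crossings_eq_zero {S : Set C} {p : List (C × Bool)} (h : ∀ s ∈ p, s.1 ∉ S) :
    crossings S p = 0 := by
  simpa [crossings, List.countP_eq_zero] using h

theorem Sub.ext {U W : Γ.Sub} (hv : U.verts = W.verts) (hc : U.cells = W.cells) : U = W := by
  cases U; cases W; cases hv; cases hc; rfl

end OGraph

namespace BFHRep

variable {n k r : ℕ} {V : Type*} (R : BFHRep n k r V) (g : R.G)

/-! ### Left translations -/

theorem moveVtx_bijective : Function.Bijective (R.moveVtx g) :=
  Function.bijective_iff_has_inverse.2 ⟨R.moveVtx g⁻¹, fun v => by simp [moveVtx],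
    fun v => by simp [moveVtx]⟩

theorem moveCell_bijective : Function.Bijective (R.moveCell g) :=
  Function.bijective_iff_has_inverse.2 ⟨R.moveCell g⁻¹, fun v => by simp [moveCell],
    fun v => by simp [moveCell]⟩

@[simp] theorem moveVtx_inj {v w : R.Vtx} : R.moveVtx g v = R.moveVtx g w ↔ v = w :=
  (R.moveVtx_bijective g).injective.eq_iff

@[simp] theorem moveCell_inj {X Y : R.HCell} : R.moveCell g X = R.moveCell g Y ↔ X = Y :=
  (R.moveCell_bijective g).injective.eq_iff

/-- These changes of variable, with their analogues for cells, subgraphs, paths and coloured trees,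
drive all the equivariance proofs: each quantifier of a definition is rewritten over translates,
after which the translation cancels. -/
theorem exists_moveVtx {P : R.Vtx → Prop} : (∃ v, P v) ↔ ∃ v, P (R.moveVtx g v) :=
  (R.moveVtx_bijective g).surjective.exists

theorem exists_moveCell {P : R.HCell → Prop} : (∃ X, P X) ↔ ∃ X, P (R.moveCell g X) :=
  (R.moveCell_bijective g).surjective.exists

theorem forall_moveVtx {P : R.Vtx → Prop} : (∀ v, P v) ↔ ∀ v, P (R.moveVtx g v) :=
  (R.moveVtx_bijective g).surjective.forall

@[simp] theorem moveCell_snd (X : R.HCell) : (R.moveCell g X).2 = X.2 := rfl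

@[simp] theorem moveVtx_fst (v : R.Vtx) : (R.moveVtx g v).1 = g * v.1 := rfl

@[simp] theorem hor_src_moveCell (X : R.HCell) :
    R.hor.src (R.moveCell g X) = R.moveVtx g (R.hor.src X) := rfl

@[simp] theorem hor_tgt_moveCell (X : R.HCell) :
    R.hor.tgt (R.moveCell g X) = R.moveVtx g (R.hor.tgt X) := by
  simp [hor, moveCell, moveVtx, mul_assoc]

@[simp] theorem mem_moveSub_verts {v : R.Vtx} {U : R.hor.Sub} :
    R.moveVtx g v ∈ (R.moveSub g U).verts ↔ v ∈ U.verts :=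
  (R.moveVtx_bijective g).injective.mem_set_image

@[simp] theorem mem_moveSub_cells {X : R.HCell} {U : R.hor.Sub} :
    R.moveCell g X ∈ (R.moveSub g U).cells ↔ X ∈ U.cells :=
  (R.moveCell_bijective g).injective.mem_set_image

/-- Testing membership only at translated points is enough by surjectivity, and keeps inverses of
`g` out of the computations. -/
theorem eq_moveSub {U W : R.hor.Sub} (hv : ∀ v, R.moveVtx g v ∈ U.verts ↔ v ∈ W.verts)
    (hc : ∀ X, R.moveCell g X ∈ U.cells ↔ X ∈ W.cells) : U = R.moveSub g W := by
  apply OGraph.Sub.ext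
  · ext v
    obtain ⟨v, rfl⟩ := (R.moveVtx_bijective g).surjective v
    rw [hv, mem_moveSub_verts]
  · ext X
    obtain ⟨X, rfl⟩ := (R.moveCell_bijective g).surjective X
    rw [hc, mem_moveSub_cells]

theorem moveSub_moveSub (g h : R.G) (U : R.hor.Sub) :
    R.moveSub g (R.moveSub h U) = R.moveSub (g * h) U := by
  apply OGraph.Sub.ext <;> simp only [moveSub, Set.image_image] <;> congr 1 <;> ext1 <;>
    simp [moveVtx, moveCell, mul_assoc]

theorem moveSub_one (U : R.hor.Sub) : R.moveSub 1 U = U := by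
  have hv : R.moveVtx 1 = id := by ext1; simp [moveVtx]
  have hc : R.moveCell 1 = id := by ext1; simp [moveCell]
  apply OGraph.Sub.ext <;> simp [moveSub, hv, hc]

theorem moveSub_bijective : Function.Bijective (R.moveSub g) :=
  Function.bijective_iff_has_inverse.2 ⟨R.moveSub g⁻¹,
    fun U => by rw [moveSub_moveSub, inv_mul_cancel, moveSub_one],
    fun U => by rw [moveSub_moveSub, mul_inv_cancel, moveSub_one]⟩

@[simp] theorem moveSub_inj {U W : R.hor.Sub} : R.moveSub g U = R.moveSub g W ↔ U = W :=
  (R.moveSub_bijective g).injective.eq_iff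

theorem exists_moveSub {P : R.hor.Sub → Prop} : (∃ U, P U) ↔ ∃ U, P (R.moveSub g U) :=
  (R.moveSub_bijective g).surjective.exists

theorem forall_moveSub {P : R.hor.Sub → Prop} : (∀ U, P U) ↔ ∀ U, P (R.moveSub g U) :=
  (R.moveSub_bijective g).surjective.forall

/-- Left-translation of horizontal edge-paths. -/
def movePath (p : List (R.HCell × Bool)) : List (R.HCell × Bool) :=
  p.map fun s => (R.moveCell g s.1, s.2)

theorem movePath_surjective : Function.Surjective (R.movePath g) :=
  List.map_surjective_iff.2 fun ⟨X, b⟩ => by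
    obtain ⟨X, rfl⟩ := (R.moveCell_bijective g).surjective X
    exact ⟨(X, b), rfl⟩

theorem exists_movePath {P : List (R.HCell × Bool) → Prop} :
    (∃ p, P p) ↔ ∃ p, P (R.movePath g p) := (R.movePath_surjective g).exists

@[simp] theorem isPath_movePath {a b : R.Vtx} {p : List (R.HCell × Bool)} :
    R.hor.IsPath (R.moveVtx g a) (R.movePath g p) (R.moveVtx g b) ↔ R.hor.IsPath a p b := by
  induction p generalizing a with
  | nil => simp [movePath]
  | cons s p ih =>
    obtain ⟨X, e⟩ := s
    simp only [movePath, List.map_cons, OGraph.isPath_cons] at ih ⊢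
    cases e <;> simp [OGraph.start, OGraph.finish, ih]

theorem isReduced_movePath {p : List (R.HCell × Bool)} :
    FreeGroup.IsReduced (R.movePath g p) ↔ FreeGroup.IsReduced p := by
  simp [FreeGroup.IsReduced, movePath, List.isChain_map]

/-- The relation between `S` and `S'` is a pointwise equivalence rather than an image, so that the
membership lemmas for `botTop`, `botStar` and singletons can be supplied as they are. -/
theorem crossings_movePath {S S' : Set R.HCell} (hS : ∀ X, R.moveCell g X ∈ S' ↔ X ∈ S)
    (p : List (R.HCell × Bool)) :
    OGraph.crossings S' (R.movePath g p) = OGraph.crossings S p := by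
  unfold OGraph.crossings movePath
  rw [List.countP_map]
  congr 1
  ext s
  exact decide_eq_decide.2 (hS s.1)

theorem forall_mem_movePath {P : R.HCell → Prop} {p : List (R.HCell × Bool)} :
    (∀ s ∈ R.movePath g p, P s.1) ↔ ∀ s ∈ p, P (R.moveCell g s.1) :=
  List.forall_mem_map

theorem oddCross_move {S S' : Set R.HCell} (hS : ∀ X, R.moveCell g X ∈ S' ↔ X ∈ S)
    {a b : R.Vtx} :
    R.hor.OddCross S' (R.moveVtx g a) (R.moveVtx g b) ↔ R.hor.OddCross S a b := by
  simp only [OGraph.OddCross]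
  rw [R.exists_movePath g]
  simp only [isPath_movePath, isReduced_movePath, R.crossings_movePath g hS]

theorem evenCross_move {S S' : Set R.HCell} (hS : ∀ X, R.moveCell g X ∈ S' ↔ X ∈ S)
    {a b : R.Vtx} :
    R.hor.EvenCross S' (R.moveVtx g a) (R.moveVtx g b) ↔ R.hor.EvenCross S a b := by
  simp only [OGraph.EvenCross]
  rw [R.exists_movePath g]
  simp only [isPath_movePath, isReduced_movePath, R.crossings_movePath g hS]

/-! ### Equivariance of the operations on subgraphs -/

theorem connected_moveSub {U : R.hor.Sub} : (R.moveSub g U).Connected ↔ U.Connected := by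
  simp only [OGraph.Sub.Connected]
  rw [R.forall_moveVtx g]
  refine forall_congr' fun a => ?_
  rw [mem_moveSub_verts, R.forall_moveVtx g]
  refine imp_congr_right fun _ => forall_congr' fun b => ?_
  rw [mem_moveSub_verts, R.exists_movePath g]
  simp only [isPath_movePath, R.forall_mem_movePath g (P := fun X => X ∈ (R.moveSub g U).cells),
    mem_moveSub_cells]

theorem isSub_moveSub {U W : R.hor.Sub} : (R.moveSub g U).IsSub (R.moveSub g W) ↔ U.IsSub W :=
  and_congr (Set.image_subset_image_iff (R.moveVtx_bijective g).injective)
    (Set.image_subset_image_iff (R.moveCell_bijective g).injective)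

/-- Translation permutes the subgraphs, so it carries the family being intersected onto the
translated family. Hulls and completions are both of this form. -/
theorem smallest_move {P P' : R.hor.Sub → Prop} (hP : ∀ U, P' (R.moveSub g U) ↔ P U) :
    OGraph.Sub.smallest P' = R.moveSub g (OGraph.Sub.smallest P) := by
  apply eq_moveSub
  · intro v
    simp only [OGraph.Sub.smallest, Set.mem_ofPred_eq]
    rw [R.forall_moveSub g]
    simp only [hP, mem_moveSub_verts]
  · intro X
    simp only [OGraph.Sub.smallest, Set.mem_ofPred_eq]
    rw [R.forall_moveSub g]
    simp only [hP, mem_moveSub_cells]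

theorem hull_moveSub (U : R.hor.Sub) : (R.moveSub g U).hull = R.moveSub g U.hull :=
  R.smallest_move g fun S => by rw [connected_moveSub, isSub_moveSub]

theorem sUnion_move {F F' : Set R.hor.Sub} (hF : ∀ U, R.moveSub g U ∈ F' ↔ U ∈ F) :
    OGraph.Sub.sUnion F' = R.moveSub g (OGraph.Sub.sUnion F) := by
  apply eq_moveSub
  · intro v
    simp only [OGraph.Sub.sUnion, Set.mem_ofPred_eq]
    rw [R.exists_moveSub g]
    simp only [hF, mem_moveSub_verts]
  · intro X
    simp only [OGraph.Sub.sUnion, Set.mem_ofPred_eq]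
    rw [R.exists_moveSub g]
    simp only [hF, mem_moveSub_cells]

theorem span_move {A A' : Set R.Vtx} {S S' : Set R.HCell}
    (hA : ∀ v, R.moveVtx g v ∈ A' ↔ v ∈ A) (hS : ∀ X, R.moveCell g X ∈ S' ↔ X ∈ S) :
    OGraph.Sub.span R.hor A' S' = R.moveSub g (OGraph.Sub.span R.hor A S) := by
  apply eq_moveSub
  · intro v
    simp only [OGraph.Sub.span, Set.mem_union, Set.mem_image, hA]
    rw [R.exists_moveCell g, R.exists_moveCell g (P := fun X => X ∈ S' ∧ R.hor.tgt X = _)]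
    simp [hS]
  · exact hS

theorem outgoing_moveSub {U : R.hor.Sub} {X : R.HCell} :
    R.Outgoing (R.moveSub g U) (R.moveCell g X) ↔ R.Outgoing U X := by
  simp only [Outgoing]
  rw [R.exists_moveVtx g]
  simp

theorem incoming_moveSub {U : R.hor.Sub} {X : R.HCell} :
    R.Incoming (R.moveSub g U) (R.moveCell g X) ↔ R.Incoming U X := by
  simp only [Incoming]
  rw [R.exists_moveVtx g]
  simp

theorem crown_moveSub {U : R.hor.Sub} {X : R.HCell} :
    R.moveCell g X ∈ R.crown (R.moveSub g U) ↔ X ∈ R.crown U :=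
  or_congr (R.incoming_moveSub g) (R.outgoing_moveSub g)

theorem completion_moveSub (U : R.hor.Sub) :
    R.completion (R.moveSub g U) = R.moveSub g (R.completion U) := by
  refine R.smallest_move g fun S => ?_
  rw [connected_moveSub, isSub_moveSub, R.sUnion_move g
    (F := {S, OGraph.Sub.span R.hor ∅ (R.crown U)}), connected_moveSub]
  intro W
  rw [R.span_move g (A := ∅) (S := R.crown U) (by simp) fun X => R.crown_moveSub g]
  simp

theorem coherent_moveSub {U : R.hor.Sub} {X Y : R.HCell} :
    R.Coherent (R.moveSub g U) (R.moveCell g X) (R.moveCell g Y) ↔ R.Coherent U X Y := by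
  simp only [Coherent, incoming_moveSub, outgoing_moveSub, moveCell_snd]

theorem twins_moveSub {U : R.hor.Sub} {X Y : R.HCell} :
    R.Twins (R.moveSub g U) (R.moveCell g X) (R.moveCell g Y) ↔ R.Twins U X Y := by
  simp only [Twins, coherent_moveSub, moveCell_snd, hor_src_moveCell, hor_tgt_moveCell,
    moveVtx_fst, mul_inv_rev, mul_assoc, inv_mul_cancel_left]

theorem pairSpans_move {S S' : Set R.HCell} (hS : ∀ X, R.moveCell g X ∈ S' ↔ X ∈ S)
    {X Y : R.HCell} :
    R.PairSpans S' (R.moveCell g X) (R.moveCell g Y) ↔ R.PairSpans S X Y := by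
  simp only [PairSpans, hor_src_moveCell, hor_tgt_moveCell, R.oddCross_move g hS]

/-- Shifts act on the left, so translating both cells conjugates the shift. This is why the
replicative subgroup of a translated biblock is a conjugate. -/
theorem shift_moveCell (X Y : R.HCell) :
    R.shift (R.moveCell g X) (R.moveCell g Y) = g * R.shift X Y * g⁻¹ := by
  simp [shift, moveCell, mul_assoc]

/-- Left translation by `g` permutes the horizontal trees through left multiplication by the image
of `g` in `F_k`. -/
theorem level_moveSub (w : FreeGroup (Fin k)) (U : R.hor.Sub) :
    R.level (g.right * w) (R.moveSub g U) = R.moveSub g (R.level w U) := by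
  apply eq_moveSub
  · intro v
    simp only [level, Set.mem_ofPred_eq, mem_moveSub_verts]
    simp [moveVtx]
  · intro X
    simp only [level, Set.mem_ofPred_eq, mem_moveSub_cells]
    simp [moveCell]

/-! ### Equivariance of tops and bottoms -/

/-- Climbing a square is a right multiplication by an element depending only on the label, hence
commutes with left translation. -/
theorem topCell_moveCell (j : Fin k) (E : R.HCell) :
    R.topCell j (R.moveCell g E) = R.moveCell g (R.topCell j E) := by
  simp [topCell, moveCell, mul_assoc]

theorem botCell_moveCell (j : Fin k) (E : R.HCell) :
    R.botCell j (R.moveCell g E) = R.moveCell g (R.botCell j E) := by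
  simp [botCell, moveCell, mul_assoc]

theorem pole_moveCell (ε : Bool) (E : R.HCell) :
    R.pole ε (R.moveCell g E) = R.moveVtx g (R.pole ε E) := by
  cases ε <;> simp [pole]

theorem up_moveVtx (j : Fin k) (v : R.Vtx) :
    R.up j (R.moveVtx g v) = R.moveVtx g (R.up j v) := by
  simp [up, moveVtx, mul_assoc]

theorem liftCells_mul (h : R.G) (p : List (Fin r × Bool)) :
    R.liftCells (g * h) p = (R.liftCells h p).map (R.moveCell g) := by
  induction p generalizing h with
  | nil => rfl
  | cons s p ih =>
    obtain ⟨e, b⟩ := s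
    cases b
    · simp only [liftCells, List.map_cons, mul_assoc, ih]; rfl
    · simp only [liftCells, List.map_cons, mul_assoc, ih]; rfl

theorem squareTop_moveCell (j : Fin k) (E : R.HCell) :
    R.squareTop j (R.moveCell g E) = (R.squareTop j E).map (R.moveCell g) := by
  rw [squareTop, squareTop, hor_src_moveCell, up_moveVtx, moveVtx_fst, liftCells_mul]
  rfl

theorem mem_squareTop_moveCell (j : Fin k) (E X : R.HCell) :
    R.moveCell g X ∈ R.squareTop j (R.moveCell g E) ↔ X ∈ R.squareTop j E := by
  rw [squareTop_moveCell, List.mem_map_of_injective (R.moveCell_bijective g).injective]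

theorem mem_botTop_moveCell (i : Fin k) (E X : R.HCell) :
    R.moveCell g X ∈ R.botTop i (R.moveCell g E) ↔ X ∈ R.botTop i E := by
  simp only [botTop, Bot, Set.mem_ofPred_eq, topCell_moveCell, mem_squareTop_moveCell]

theorem mem_botStar_moveCell (i : Fin k) (E X : R.HCell) :
    R.moveCell g X ∈ R.botStar i (R.moveCell g E) ↔ X ∈ R.botStar i E := by
  simp [botStar, mem_botTop_moveCell]

theorem mem_singleton_moveCell (E X : R.HCell) :
    R.moveCell g X ∈ ({R.moveCell g E} : Set R.HCell) ↔ X ∈ ({E} : Set R.HCell) := by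
  simp

theorem botAll_moveCell (E : R.HCell) :
    R.botAll (R.moveCell g E) = R.moveSub g (R.botAll E) :=
  R.span_move g (by simp) fun X => by simp [mem_botTop_moveCell]

theorem cylTop_moveSub (j : Fin k) (U : R.hor.Sub) :
    R.cylTop j (R.moveSub g U) = R.moveSub g (R.cylTop j U) := by
  refine R.span_move g (fun v => ?_) fun X => ?_
  · simp only [Set.mem_image]
    rw [R.exists_moveVtx g]
    simp only [mem_moveSub_verts, up_moveVtx, moveVtx_inj]
  · simp only [Set.mem_ofPred_eq]
    rw [R.exists_moveCell g]
    simp only [mem_moveSub_cells, mem_squareTop_moveCell]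

theorem Top_moveCell (E : R.HCell) : R.Top (R.moveCell g E) = R.moveSub g (R.Top E) := by
  refine R.sUnion_move g fun U => ?_
  simp only [Set.mem_ofPred_eq, topCell_moveCell, shift_moveCell, botAll_moveCell, hull_moveSub,
    cylTop_moveSub, moveSub_moveSub, inv_mul_cancel_right]
  simp only [← R.moveSub_moveSub g, moveSub_inj]

theorem TopAt_moveCell (i : Fin k) (E : R.HCell) :
    R.TopAt i (R.moveCell g E) = R.moveSub g (R.TopAt i E) := by
  simp only [TopAt, topCell_moveCell, shift_moveCell, Top_moveCell, moveSub_moveSub,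
    inv_mul_cancel_right]

theorem Bottom_moveCell (E : R.HCell) :
    R.Bottom (R.moveCell g E) = R.moveSub g (R.Bottom E) := by
  rw [Bottom, Bottom, ← completion_moveSub]
  congr 1
  refine R.span_move g (fun v => ?_) (by simp)
  simp only [Set.mem_ofPred_eq, up_moveVtx, TopAt_moveCell, mem_moveSub_verts]

/-! ### Equivariance of blocks -/

/-- Left-translation of coloured trees. -/
def moveTree (P : R.ColoredTree) : R.ColoredTree where
  dom := R.moveSub g P.dom
  pos v i := P.pos (R.moveVtx g⁻¹ v) i

@[simp] theorem moveTree_dom {P : R.ColoredTree} :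
    (R.moveTree g P).dom = R.moveSub g P.dom := rfl

@[simp] theorem moveTree_pos {P : R.ColoredTree} {v : R.Vtx} {i : Fin k} :
    (R.moveTree g P).pos (R.moveVtx g v) i ↔ P.pos v i := by
  simp [moveTree, moveVtx]

variable {R} in
theorem ColoredTree.ext {P Q : R.ColoredTree} (hd : P.dom = Q.dom)
    (hp : ∀ v i, P.pos v i ↔ Q.pos v i) : P = Q := by
  obtain ⟨d, p⟩ := P
  obtain ⟨d', p'⟩ := Q
  obtain rfl : d = d' := hd
  obtain rfl : p = p' := by ext v i; exact hp v i
  rfl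

theorem eq_moveTree {P Q : R.ColoredTree} (hd : P.dom = R.moveSub g Q.dom)
    (hp : ∀ v i, P.pos (R.moveVtx g v) i ↔ Q.pos v i) : P = R.moveTree g Q := by
  apply ColoredTree.ext hd
  intro v i
  obtain ⟨v, rfl⟩ := (R.moveVtx_bijective g).surjective v
  rw [hp, moveTree_pos]

theorem moveTree_bijective : Function.Bijective (R.moveTree g) := by
  refine Function.bijective_iff_has_inverse.2 ⟨R.moveTree g⁻¹, fun P => ?_, fun P => ?_⟩
  · refine ColoredTree.ext ?_ fun v i => ?_
    · simp [moveTree, moveSub_moveSub, moveSub_one]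
    · simp [moveTree, moveVtx]
  · refine ColoredTree.ext ?_ fun v i => ?_
    · simp [moveTree, moveSub_moveSub, moveSub_one]
    · simp [moveTree, moveVtx]

@[simp] theorem moveTree_inj {P Q : R.ColoredTree} : R.moveTree g P = R.moveTree g Q ↔ P = Q :=
  (R.moveTree_bijective g).injective.eq_iff

theorem exists_moveTree {P : R.ColoredTree → Prop} : (∃ U, P U) ↔ ∃ U, P (R.moveTree g U) :=
  (R.moveTree_bijective g).surjective.exists

theorem cTop_moveCell (ε : Bool) (I : Set (Fin k)) (E : R.HCell) :
    R.cTop ε I (R.moveCell g E) = R.moveTree g (R.cTop ε I E) := by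
  refine R.eq_moveTree g (R.Top_moveCell g E) fun v i => ?_
  simp only [cTop, pole_moveCell, hor_src_moveCell,
    R.oddCross_move g (R.mem_botStar_moveCell g i E),
    R.evenCross_move g (R.mem_singleton_moveCell g E)]

theorem cBottom_moveCell (ε : Bool) (I : Set (Fin k)) (E : R.HCell) :
    R.cBottom ε I (R.moveCell g E) = R.moveTree g (R.cBottom ε I E) := by
  refine R.eq_moveTree g (R.Bottom_moveCell g E) fun v i => ?_
  simp only [cBottom, pole_moveCell, hor_src_moveCell,
    R.oddCross_move g (R.mem_botStar_moveCell g i E),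
    R.evenCross_move g (R.mem_botTop_moveCell g i E)]

theorem mem_blockNuclei_moveCell (I : Set (Fin k)) (E X : R.HCell) :
    R.moveCell g X ∈ R.blockNuclei I (R.moveCell g E) ↔ X ∈ R.blockNuclei I E := by
  simp only [blockNuclei, Set.mem_ofPred_eq, topCell_moveCell, moveCell_inj]

theorem mem_block_moveCell (ε : Bool) (I : Set (Fin k)) (E : R.HCell) (P : R.ColoredTree) :
    R.moveTree g P ∈ R.block ε I (R.moveCell g E) ↔ P ∈ R.block ε I E := by
  simp only [block, Set.mem_ofPred_eq, topCell_moveCell, cTop_moveCell, cBottom_moveCell,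
    moveTree_inj]

theorem conj_eq_conj {s t : R.G} : g * s * g⁻¹ = g * t * g⁻¹ ↔ s = t := by
  simp

theorem mem_blockLifts_moveCell (I : Set (Fin k)) (E : R.HCell) (s : R.G) :
    g * s * g⁻¹ ∈ R.blockLifts I (R.moveCell g E) ↔ s ∈ R.blockLifts I E := by
  simp only [blockLifts, Set.mem_ofPred_eq, botCell_moveCell, shift_moveCell, conj_eq_conj]

theorem mem_blockStairs_moveCell (δ : Bool) (I : Set (Fin k)) (E : R.HCell) (s : R.G) :
    g * s * g⁻¹ ∈ R.blockStairs δ I (R.moveCell g E) ↔ s ∈ R.blockStairs δ I E := by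
  simp only [blockStairs, Set.mem_ofPred_eq, topCell_moveCell, Top_moveCell, Bottom_moveCell]
  refine exists_congr fun i => and_congr_right fun _ => ?_
  rw [R.exists_moveCell g]; refine exists_congr fun X => ?_
  rw [R.exists_moveCell g]; refine exists_congr fun Y => ?_
  rw [R.exists_moveCell g]; refine exists_congr fun X' => ?_
  rw [R.exists_moveCell g]; refine exists_congr fun Y' => ?_
  rw [twins_moveSub, twins_moveSub, R.pairSpans_move g (R.mem_singleton_moveCell g E),
    R.pairSpans_move g (R.mem_singleton_moveCell g _)]
  cases δ <;> simp only [shift_moveCell, moveCell_snd, if_true, if_false, Bool.false_eq_true,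
    conj_eq_conj]

theorem spanningPair_moveCell (E X Y : R.HCell) :
    R.SpanningPair (R.moveCell g E) (R.moveCell g X) (R.moveCell g Y) ↔ R.SpanningPair E X Y := by
  simp only [SpanningPair, Bottom_moveCell, twins_moveSub,
    R.pairSpans_move g (R.mem_botStar_moveCell g _ E)]

/-! ### Equivariance of biblocks and cuts -/

variable {R}

/-- Left-translation of companions. -/
def Companion.move (g : R.G) (C : R.Companion) : R.Companion where
  X := R.moveCell g C.X
  Y := R.moveCell g C.Y
  bridgeIsX := C.bridgeIsX
  ε := C.ε

theorem Companion.h_move (C : R.Companion) : (C.move g).h = g * C.h * g⁻¹ := by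
  obtain ⟨X, Y, b, ε⟩ := C
  cases b <;> simp [Companion.h, Companion.move, shift_moveCell]

theorem Companion.Z_move (C : R.Companion) (E : R.HCell) :
    (C.move g).Z (R.moveCell g E) = R.moveCell g (C.Z E) := by
  simp [Companion.Z, C.h_move, moveCell, mul_assoc]

/-- Left-translation of biblocks. -/
def Biblock.move (g : R.G) (b : R.Biblock) : R.Biblock where
  E := R.moveCell g b.E
  I := b.I
  comp := b.comp.map (Companion.move g)

namespace Biblock

variable (b : R.Biblock) (κ : WallConvention)

theorem mem_blocks_move (ε : Bool) (I : Set (Fin k)) (E : R.HCell) :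
    (ε, I, R.moveCell g E) ∈ (b.move g).blocks ↔ (ε, I, E) ∈ b.blocks := by
  simp only [blocks, Set.mem_ofPred_eq, move, Prod.mk.injEq, moveCell_inj, Option.map_eq_some_iff]
  refine or_congr_right ⟨?_, ?_⟩
  · rintro ⟨_, ⟨C, hC, rfl⟩, h1, h2, h3⟩
    rw [C.Z_move, moveCell_inj] at h3
    exact ⟨C, hC, h1, h2, h3⟩
  · rintro ⟨C, hC, h1, h2, h3⟩
    exact ⟨_, ⟨C, hC, rfl⟩, h1, h2, by rw [C.Z_move, h3]⟩

theorem exists_mem_blocks_move {P : Bool × Set (Fin k) × R.HCell → Prop} :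
    (∃ q ∈ (b.move g).blocks, P q) ↔ ∃ q ∈ b.blocks, P (q.1, q.2.1, R.moveCell g q.2.2) := by
  constructor
  · rintro ⟨⟨ε, I, E⟩, hq, h⟩
    obtain ⟨E, rfl⟩ := (R.moveCell_bijective g).surjective E
    exact ⟨_, (b.mem_blocks_move g ε I E).1 hq, h⟩
  · rintro ⟨⟨ε, I, E⟩, hq, h⟩
    exact ⟨_, (b.mem_blocks_move g ε I E).2 hq, h⟩

theorem mem_parts_move (P : R.ColoredTree) :
    R.moveTree g P ∈ (b.move g).parts ↔ P ∈ b.parts := by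
  simp only [parts, Set.mem_ofPred_eq]
  rw [exists_mem_blocks_move]
  simp only [mem_block_moveCell]

theorem union_move : (b.move g).union = R.moveSub g b.union := by
  refine R.sUnion_move g fun U => ?_
  simp only [Set.mem_ofPred_eq]
  rw [R.exists_moveTree g]
  simp only [mem_parts_move, moveTree_dom, moveSub_inj]

theorem mem_verts_move (v : R.Vtx) : R.moveVtx g v ∈ (b.move g).verts ↔ v ∈ b.verts := by
  obtain ⟨E, I, c⟩ := b
  cases c with
  | none =>
    change _ ∈ (Biblock.union (Biblock.move g ⟨E, I, none⟩)).verts ↔ _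
    rw [union_move, mem_moveSub_verts]
    rfl
  | some C =>
    change R.moveVtx g v ∈ (R.completion (R.level (R.moveVtx g v).1.right
      (Biblock.union (Biblock.move g ⟨E, I, some C⟩)))).verts ↔ _
    rw [union_move, moveVtx_fst, SemidirectProduct.mul_right, level_moveSub, completion_moveSub,
      mem_moveSub_verts]
    rfl

theorem colour_move (v : R.Vtx) : (b.move g).colour (R.moveVtx g v) = b.colour v := by
  ext i
  simp only [colour, Set.mem_ofPred_eq]
  rw [R.exists_moveTree g]
  refine exists_congr fun P => ?_
  rw [mem_parts_move, moveTree_pos, R.exists_moveVtx g]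
  refine and_congr_right fun _ => and_congr_right fun _ => exists_congr fun a => ?_
  rw [R.exists_movePath g]
  simp only [moveTree_dom, mem_moveSub_verts, isPath_movePath, union_move,
    R.forall_mem_movePath g (P := fun X => X ∉ (R.moveSub g b.union).cells), mem_moveSub_cells]

theorem enabled_move (X Y : R.HCell) :
    (b.move g).Enabled (R.moveCell g X) (R.moveCell g Y) ↔ b.Enabled X Y := by
  simp only [Enabled, hor_src_moveCell, hor_tgt_moveCell, colour_move]

theorem mirrorPair_move (X Y : R.HCell) :
    (b.move g).MirrorPair (R.moveCell g X) (R.moveCell g Y) ↔ b.MirrorPair X Y := by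
  -- The shift `h` of the translated companion is a conjugate, and the conjugating factor cancels
  -- against the translation of the cell.
  have key : ∀ h (Z : R.HCell), R.moveCell (g * h * g⁻¹) (R.moveCell g Z) =
      R.moveCell g (R.moveCell h Z) := fun h Z => by simp [moveCell, mul_assoc]
  have hC : (b.move g).MirrorPair (R.moveCell g X) (R.moveCell g Y) ↔
      ∃ C, b.comp = some C ∧ ∃ P Q, R.SpanningPair (R.moveCell g b.E) P Q ∧
      ((R.moveCell g X = R.moveCell (C.move g).h P ∧ R.moveCell g Y = Q) ∨
        (R.moveCell g X = P ∧ R.moveCell g Y = R.moveCell (C.move g).h Q)) := by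
    simp only [MirrorPair, move, Option.map_eq_some_iff]
    constructor
    · rintro ⟨_, ⟨C, hC, rfl⟩, h⟩; exact ⟨C, hC, h⟩
    · rintro ⟨C, hC, h⟩; exact ⟨_, ⟨C, hC, rfl⟩, h⟩
  rw [hC]
  refine exists_congr fun C => and_congr_right fun _ => ?_
  rw [R.exists_moveCell g]; refine exists_congr fun P => ?_
  rw [R.exists_moveCell g]; refine exists_congr fun Q => ?_
  simp only [spanningPair_moveCell, C.h_move, key, moveCell_inj]

theorem mem_horizontalGenerators_move (s : R.G) :
    g * s * g⁻¹ ∈ (b.move g).horizontalGenerators κ ↔ s ∈ b.horizontalGenerators κ := by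
  simp only [horizontalGenerators, Set.mem_ofPred_eq]
  rw [R.exists_moveCell g]; refine exists_congr fun X => ?_
  rw [R.exists_moveCell g]; refine exists_congr fun Y => ?_
  rw [R.exists_moveTree g]
  simp only [enabled_move, shift_moveCell, conj_eq_conj, mem_parts_move, moveTree_dom,
    coherent_moveSub, twins_moveSub, mirrorPair_move]

theorem mem_stairs_move (s : R.G) :
    g * s * g⁻¹ ∈ (b.move g).stairs κ ↔ s ∈ b.stairs κ := by
  simp only [stairs, Set.mem_ofPred_eq]
  rw [exists_mem_blocks_move]
  simp only [mem_blockStairs_moveCell]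

theorem mem_lifts_move (s : R.G) : g * s * g⁻¹ ∈ (b.move g).lifts ↔ s ∈ b.lifts := by
  simp only [lifts, Set.mem_ofPred_eq]
  rw [exists_mem_blocks_move]
  simp only [mem_blockLifts_moveCell]

/-- Conjugation by `g` carries each family of generators (lifts, horizontal generators, stairs) onto
the corresponding family of the translate. -/
theorem replicative_move :
    (b.move g).replicative κ = (b.replicative κ).map (MulAut.conj g).toMonoidHom := by
  rw [replicative, replicative, MonoidHom.map_closure]
  congr 1
  ext s
  obtain ⟨s, rfl⟩ := (MulAut.conj g).surjective s
  rw [MulEquiv.coe_toMonoidHom, (MulAut.conj g).injective.mem_set_image, MulAut.conj_apply]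
  simp only [diagonalGenerators, Set.mem_union, mem_lifts_move, mem_horizontalGenerators_move,
    mem_stairs_move]

/-- Left-translation of the 1-cells of the mapping-cylinder. -/
def _root_.BFHRep.moveEdge (g : R.G) : R.HCell ⊕ R.VCell → R.HCell ⊕ R.VCell :=
  Sum.map (fun X => (g * X.1, X.2)) fun X => (g * X.1, X.2)

theorem _root_.BFHRep.moveEdge_mul (g h : R.G) (d : R.HCell ⊕ R.VCell) :
    moveEdge (g * h) d = moveEdge g (moveEdge h d) := by
  rcases d with d | d <;> simp [moveEdge, mul_assoc]

theorem _root_.BFHRep.moveEdge_one (d : R.HCell ⊕ R.VCell) :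
    moveEdge (1 : R.G) d = d := by
  rcases d with d | d <;> simp [moveEdge]

/-- Freeness of the action on 1-cells: the position of a cell is an element of `G`, on which `G`
acts by left multiplication. -/
theorem _root_.BFHRep.moveEdge_free {g h : R.G} {d : R.HCell ⊕ R.VCell}
    (H : moveEdge g d = moveEdge h d) : g = h := by
  rcases d with d | d <;> simpa [moveEdge] using H

theorem elementaryCuts_move :
    (b.move g).elementaryCuts = moveEdge g '' b.elementaryCuts := by
  ext c
  simp only [elementaryCuts, Set.mem_ofPred_eq, Set.mem_image]
  rw [exists_mem_blocks_move]
  constructor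
  · rintro (⟨q, hq, N, hN, rfl⟩ | ⟨v, hv, i, hi, rfl⟩)
    · obtain ⟨N, rfl⟩ := (R.moveCell_bijective g).surjective N
      rw [mem_blockNuclei_moveCell] at hN
      exact ⟨_, Or.inl ⟨q, hq, N, hN, rfl⟩, rfl⟩
    · obtain ⟨v, rfl⟩ := (R.moveVtx_bijective g).surjective v
      rw [mem_verts_move] at hv
      rw [colour_move] at hi
      exact ⟨_, Or.inr ⟨v, hv, i, hi, rfl⟩, rfl⟩
  · rintro ⟨_, ⟨q, hq, N, hN, rfl⟩ | ⟨v, hv, i, hi, rfl⟩, rfl⟩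
    · exact Or.inl ⟨q, hq, R.moveCell g N, (R.mem_blockNuclei_moveCell g _ _ _).2 hN, rfl⟩
    · exact Or.inr ⟨R.moveVtx g v, (b.mem_verts_move g v).2 hv, i,
        (b.colour_move g v).symm ▸ hi, rfl⟩

theorem mem_cuts {c : R.HCell ⊕ R.VCell} :
    c ∈ b.cuts κ ↔ ∃ g ∈ b.replicative κ, ∃ d ∈ b.elementaryCuts, c = moveEdge g d := Iff.rfl

/-- A translated cut has the form `(g * h * g⁻¹) * g` applied to an elementary cut, that is `g * h`:
the conjugation of the subgroup is absorbed by the translation of the elementary cuts. -/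
theorem cuts_move : (b.move g).cuts κ = moveEdge g '' b.cuts κ := by
  ext c
  simp only [Set.mem_image, mem_cuts, replicative_move, elementaryCuts_move, Subgroup.mem_map]
  constructor
  · rintro ⟨_, ⟨h, hh, rfl⟩, _, ⟨d, hd, rfl⟩, rfl⟩
    refine ⟨_, ⟨h, hh, d, hd, rfl⟩, ?_⟩
    rw [← moveEdge_mul, ← moveEdge_mul]
    simp
  · rintro ⟨_, ⟨h, hh, d, hd, rfl⟩, rfl⟩
    refine ⟨_, ⟨h, hh, rfl⟩, _, ⟨d, hd, rfl⟩, ?_⟩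
    rw [← moveEdge_mul, ← moveEdge_mul]
    simp

theorem moveEdge_image_cuts {h : R.G} (hh : h ∈ b.replicative κ) :
    moveEdge h '' b.cuts κ = b.cuts κ := by
  have key : ∀ h ∈ b.replicative κ, moveEdge h '' b.cuts κ ⊆ b.cuts κ := by
    rintro h hh _ ⟨_, ⟨s, hs, d, hd, rfl⟩, rfl⟩
    exact ⟨h * s, mul_mem hh hs, d, hd, (moveEdge_mul h s d).symm⟩
  refine (key h hh).antisymm fun c hc => ⟨moveEdge h⁻¹ c, key _ (inv_mem hh) ⟨c, hc, rfl⟩, ?_⟩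
  rw [← moveEdge_mul, mul_inv_cancel, moveEdge_one]

end Biblock

end BFHRep

/-! ### Subpaths and connected subgraphs -/

namespace OGraph

variable {V C : Type*} {Γ : OGraph V C}

theorem IsPath.exists_prefix {a b : V} {p : List (C × Bool)} (hp : Γ.IsPath a p b)
    {s : C × Bool} (hs : s ∈ p) : ∃ q, q ⊆ p ∧ Γ.IsPath a q (Γ.start s) := by
  induction p generalizing a with
  | nil => simp at hs
  | cons t p ih =>
    rcases List.mem_cons.1 hs with rfl | hs
    · exact ⟨[], by simp, hp.1.symm⟩
    · obtain ⟨q, hq, hq'⟩ := ih hp.2 hs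
      exact ⟨t :: q, List.cons_subset_cons t hq, hp.1, hq'⟩

/-- Both endpoints of a cell crossed by a path are joined to the origin of the path inside it. -/
theorem IsPath.exists_subpath {a b : V} {p : List (C × Bool)} (hp : Γ.IsPath a p b)
    {s : C × Bool} (hs : s ∈ p) :
    (∃ q, q ⊆ p ∧ Γ.IsPath a q (Γ.src s.1)) ∧ ∃ q, q ⊆ p ∧ Γ.IsPath a q (Γ.tgt s.1) := by
  obtain ⟨q, hq, hq'⟩ := hp.exists_prefix hs
  have h1 : ∃ q, q ⊆ p ∧ Γ.IsPath a q (Γ.finish s) :=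
    ⟨q ++ [s], by simp [hq, hs], hq'.append ⟨rfl, rfl⟩⟩
  have h0 : ∃ q, q ⊆ p ∧ Γ.IsPath a q (Γ.start s) := ⟨q, hq, hq'⟩
  obtain ⟨c, b⟩ := s
  cases b
  · exact ⟨h1, h0⟩
  · exact ⟨h0, h1⟩

theorem Sub.connected_of_base {U : Γ.Sub} (a : V)
    (h : ∀ b ∈ U.verts, ∃ p, Γ.IsPath a p b ∧ ∀ s ∈ p, s.1 ∈ U.cells) : U.Connected := by
  intro b hb c hc
  obtain ⟨p, hp, hp'⟩ := h b hb
  obtain ⟨q, hq, hq'⟩ := h c hc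
  refine ⟨_, hp.reverse.append hq, fun s hs => ?_⟩
  rcases List.mem_append.1 hs with hs | hs
  · obtain ⟨s', h1, h2⟩ := mem_invRev hs
    exact h2 ▸ hp' s' h1
  · exact hq' s hs

theorem Sub.smallest_isSub {P : Γ.Sub → Prop} {S : Γ.Sub} (hS : P S) : (smallest P).IsSub S :=
  ⟨fun _ hv => hv S hS, fun _ hc => hc S hS⟩

end OGraph

namespace BFHRep

variable {n k r : ℕ} {V : Type*} (R : BFHRep n k r V)

/-! ### The horizontal trees are connected -/

/-- Path lifting from the graph to its covering: the `F_n`-word read along the path gives the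
displacement of the position. -/
theorem exists_lift_path (p : List (Fin r × Bool)) {u v : V} (hp : R.IsPath u p v) (g : R.G) :
    ∃ q, R.hor.IsPath (g, u) q (g * R.hz (R.read p), v) := by
  induction p generalizing g u with
  | nil =>
    obtain rfl : u = v := hp
    exact ⟨[], by simp [FilteredGraph.read, hz]⟩
  | cons s p ih =>
    obtain ⟨e, b⟩ := s
    obtain ⟨rfl, hp⟩ := hp
    cases b
    · obtain ⟨q, hq⟩ := ih hp (g * (R.hz (R.label e))⁻¹)
      refine ⟨((g * (R.hz (R.label e))⁻¹, e), false) :: q, ?_, ?_⟩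
      · simp [OGraph.start, hor]
      · have hr : g * R.hz (R.read ((e, false) :: p)) =
            g * (R.hz (R.label e))⁻¹ * R.hz (R.read p) := by
          simp [FilteredGraph.read, hz, mul_assoc]
        rw [hr]
        simpa [OGraph.finish, hor] using hq
    · obtain ⟨q, hq⟩ := ih hp (g * R.hz (R.label e))
      refine ⟨((g, e), true) :: q, ?_, ?_⟩
      · simp [OGraph.start, hor]
      · have hr : g * R.hz (R.read ((e, true) :: p)) =
            g * R.hz (R.label e) * R.hz (R.read p) := by
          simp [FilteredGraph.read, hz, mul_assoc]
        rw [hr]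
        simpa [OGraph.finish, hor] using hq

theorem read_eq_one {p : List (Fin r × Bool)} (hp : ∀ s ∈ p, R.gen s.1 = none) :
    R.read p = 1 := by
  refine List.prod_eq_one fun x hx => ?_
  obtain ⟨s, hs, rfl⟩ := List.mem_map.1 hx
  simp [FilteredGraph.label, hp s hs]

theorem exists_path_tree (g : R.G) (u v : V) : ∃ q, R.hor.IsPath (g, u) q (g, v) := by
  obtain ⟨p, ⟨hp, -, hp'⟩, -⟩ := R.maxTree u v
  obtain ⟨q, hq⟩ := R.exists_lift_path p hp g
  rw [R.read_eq_one hp'] at hq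
  exact ⟨q, by simpa [hz] using hq⟩

theorem exists_path_hz (x : FreeGroup (Fin n)) (g : R.G) (v : V) :
    ∃ q, R.hor.IsPath (g, v) q (g * R.hz x, v) := by
  have key : ∀ i g, ∃ q, R.hor.IsPath (g, v) q (g * R.hz (FreeGroup.of i), v) := by
    -- Inside one copy of the maximal tree the position is constant. The path goes there to the
    -- origin of the essential cell labelled `x_i`, crosses it, and comes back in the next copy.
    intro i g
    obtain ⟨e, he, -⟩ := R.gen_bij i
    obtain ⟨p, hp⟩ := R.exists_path_tree g v (R.src e)
    obtain ⟨q, hq⟩ := R.exists_lift_path [(e, true)] (u := R.src e) (v := R.tgt e)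
      ⟨rfl, rfl⟩ g
    obtain ⟨s, hs⟩ := R.exists_path_tree (g * R.hz (FreeGroup.of i)) (R.tgt e) v
    have hr : R.read [(e, true)] = FreeGroup.of i := by
      simp [FilteredGraph.read, FilteredGraph.label, he]
    rw [hr] at hq
    exact ⟨_, (hp.append hq).append hs⟩
  induction x using FreeGroup.induction_on generalizing g with
  | C1 => exact ⟨[], by simp [hz]⟩
  | of i => exact key i g
  | inv_of i _ =>
    obtain ⟨q, hq⟩ := key i (g * R.hz (FreeGroup.of i)⁻¹)
    refine ⟨_, OGraph.IsPath.reverse (p := q) ?_⟩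
    convert hq using 2
    simp [hz]
  | mul x y hx hy =>
    obtain ⟨p, hp⟩ := hx g
    obtain ⟨q, hq⟩ := hy (g * R.hz x)
    refine ⟨p ++ q, hp.append ?_⟩
    convert hq using 2
    simp [hz, mul_assoc]

/-- Positions with the same image in `F_k` differ by an element of `F_n` on the right, which a
horizontal path realizes; a path in the final copy of the maximal tree then corrects the vertex. -/
theorem exists_path_of_right_eq {a b : R.Vtx} (h : a.1.right = b.1.right) :
    ∃ q, R.hor.IsPath a q b := by
  obtain ⟨p, hp⟩ := R.exists_path_hz (a.1⁻¹ * b.1).left a.1 a.2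
  have hb : a.1 * R.hz (a.1⁻¹ * b.1).left = b.1 := by
    have h1 : R.hz (a.1⁻¹ * b.1).left = a.1⁻¹ * b.1 := by
      apply SemidirectProduct.ext
      · simp [hz]
      · simp [hz, h]
    rw [h1, mul_inv_cancel_left]
  rw [hb] at hp
  obtain ⟨q, hq⟩ := R.exists_path_tree b.1 a.2 b.2
  exact ⟨p ++ q, hp.append hq⟩

@[simp] theorem hor_src_right (X : R.HCell) : (R.hor.src X).1.right = X.1.right := rfl

@[simp] theorem hor_tgt_right (X : R.HCell) : (R.hor.tgt X).1.right = X.1.right := by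
  simp [hor, hz]

theorem isPath_right {a b : R.Vtx} {p : List (R.HCell × Bool)} (hp : R.hor.IsPath a p b) :
    ∀ s ∈ p, s.1.1.right = a.1.right := by
  induction p generalizing a with
  | nil => simp
  | cons s p ih =>
    obtain ⟨X, e⟩ := s
    obtain ⟨rfl, hp⟩ := hp
    have h : ∀ d, (R.hor.start (X, d)).1.right = X.1.right ∧
        (R.hor.finish (X, d)).1.right = X.1.right := by
      intro d; cases d <;> simp [OGraph.start, OGraph.finish]
    rintro t ht
    rcases List.mem_cons.1 ht with rfl | ht
    · exact (h e).1.symm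
    · rw [ih hp t ht, (h e).1, (h e).2]

/-! ### Finite subgraphs of a horizontal tree -/

/-- `U` is a finite subgraph of the horizontal tree over `w`. -/
structure FiniteAt (w : FreeGroup (Fin k)) (U : R.hor.Sub) : Prop where
  verts : U.verts.Finite
  cells : U.cells.Finite
  right : ∀ v ∈ U.verts, v.1.right = w

variable {R}

theorem FiniteAt.mono {w : FreeGroup (Fin k)} {U W : R.hor.Sub} (hW : R.FiniteAt w W)
    (h : U.IsSub W) : R.FiniteAt w U :=
  ⟨hW.verts.subset h.1, hW.cells.subset h.2, fun v hv => hW.right v (h.1 hv)⟩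

theorem FiniteAt.cells_right {w : FreeGroup (Fin k)} {U : R.hor.Sub} (hU : R.FiniteAt w U)
    {X : R.HCell} (hX : X ∈ U.cells) : X.1.right = w := hU.right _ (U.src_mem X hX)

theorem finiteAt_span {w : FreeGroup (Fin k)} {A : Set R.Vtx} {D : Set R.HCell}
    (hA : A.Finite) (hD : D.Finite) (hAw : ∀ v ∈ A, v.1.right = w)
    (hDw : ∀ X ∈ D, X.1.right = w) : R.FiniteAt w (OGraph.Sub.span R.hor A D) where
  verts := hA.union ((hD.image _).union (hD.image _))
  cells := hD
  right := by
    rintro v (hv | ⟨X, hX, rfl⟩ | ⟨X, hX, rfl⟩)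
    · exact hAw v hv
    · exact hDw X hX
    · rw [hor_tgt_right, hDw X hX]

theorem FiniteAt.moveSub {w : FreeGroup (Fin k)} {U : R.hor.Sub} (hU : R.FiniteAt w U)
    (g : R.G) : R.FiniteAt (g.right * w) (R.moveSub g U) where
  verts := hU.verts.image _
  cells := hU.cells.image _
  right := by
    rintro _ ⟨v, hv, rfl⟩
    rw [moveVtx_fst, SemidirectProduct.mul_right, hU.right v hv]

theorem finiteAt_sUnion {ι : Type*} [Finite ι] {w : FreeGroup (Fin k)} {U : ι → R.hor.Sub}
    (hU : ∀ i, R.FiniteAt w (U i)) : R.FiniteAt w (OGraph.Sub.sUnion {W | ∃ i, W = U i}) where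
  verts := (Set.finite_iUnion fun i => (hU i).verts).subset <| by
    rintro v ⟨_, ⟨i, rfl⟩, hv⟩
    exact Set.mem_iUnion.2 ⟨i, hv⟩
  cells := (Set.finite_iUnion fun i => (hU i).cells).subset <| by
    rintro v ⟨_, ⟨i, rfl⟩, hv⟩
    exact Set.mem_iUnion.2 ⟨i, hv⟩
  right := by
    rintro v ⟨_, ⟨i, rfl⟩, hv⟩
    exact (hU i).right v hv

/-- Every finite subgraph of a horizontal tree is contained in a finite subtree. -/
theorem FiniteAt.exists_connected {w : FreeGroup (Fin k)} {U : R.hor.Sub}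
    (hU : R.FiniteAt w U) : ∃ S : R.hor.Sub, S.Connected ∧ U.IsSub S ∧ R.FiniteAt w S := by
  rcases U.verts.eq_empty_or_nonempty with h0 | ⟨a, ha⟩
  · exact ⟨U, by simp [OGraph.Sub.Connected, h0], ⟨subset_rfl, subset_rfl⟩, hU⟩
  -- The membership condition sits under the existential, with the empty path as default, so that
  -- `choose` yields a function on all vertices. The subtree is the union of `U` with these paths
  -- from the base vertex `a`.
  have hp : ∀ b : R.Vtx, ∃ p, b ∈ U.verts → R.hor.IsPath a p b := fun b => by
    by_cases hb : b ∈ U.verts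
    · obtain ⟨p, hp⟩ := R.exists_path_of_right_eq ((hU.right a ha).trans (hU.right b hb).symm)
      exact ⟨p, fun _ => hp⟩
    · exact ⟨[], fun h => absurd h hb⟩
  choose p hp using hp
  let D : Set R.HCell := (⋃ b ∈ U.verts, {X | ∃ s ∈ p b, s.1 = X}) ∪ U.cells
  have hD : D.Finite := by
    refine (hU.verts.biUnion fun b _ => ?_).union hU.cells
    exact ((p b).finite_toSet.image Prod.fst).subset fun X ⟨s, hs, h⟩ => ⟨s, hs, h⟩
  have hpD : ∀ b ∈ U.verts, ∀ s ∈ p b, s.1 ∈ D := fun b hb s hs =>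
    Or.inl (Set.mem_biUnion hb ⟨s, hs, rfl⟩)
  refine ⟨OGraph.Sub.span R.hor U.verts D, ?_, ⟨Set.subset_union_left, Set.subset_union_right⟩,
    finiteAt_span hU.verts hD hU.right ?_⟩
  · have hverts : ∀ b ∈ U.verts, ∃ q, R.hor.IsPath a q b ∧ ∀ s ∈ q, s.1 ∈ D :=
      fun b hb => ⟨p b, hp b hb, hpD b hb⟩
    refine OGraph.Sub.connected_of_base a ?_
    rintro b (hb | ⟨X, hX | hX, rfl⟩ | ⟨X, hX | hX, rfl⟩)
    · exact hverts b hb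
    · obtain ⟨b, hb, s, hs, rfl⟩ := Set.mem_iUnion₂.1 hX
      obtain ⟨q, hq, hq'⟩ := ((hp b hb).exists_subpath hs).1
      exact ⟨q, hq', fun s hs => hpD b hb s (hq hs)⟩
    · exact hverts _ (U.src_mem X hX)
    · obtain ⟨b, hb, s, hs, rfl⟩ := Set.mem_iUnion₂.1 hX
      obtain ⟨q, hq, hq'⟩ := ((hp b hb).exists_subpath hs).2
      exact ⟨q, hq', fun s hs => hpD b hb s (hq hs)⟩
    · exact hverts _ (U.tgt_mem X hX)
  · rintro X (hX | hX)
    · obtain ⟨b, hb, s, hs, rfl⟩ := Set.mem_iUnion₂.1 hX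
      rw [R.isPath_right (hp b hb) s hs, hU.right a ha]
    · exact hU.cells_right hX

/-- An intersection is finite as soon as one member of the family is; a finite subtree containing
`U` is such a member. -/
theorem FiniteAt.hull {w : FreeGroup (Fin k)} {U : R.hor.Sub} (hU : R.FiniteAt w U) :
    R.FiniteAt w U.hull := by
  obtain ⟨S, hS, hUS, hf⟩ := hU.exists_connected
  exact hf.mono (OGraph.Sub.smallest_isSub ⟨hS, hUS⟩)

theorem crown_right {w : FreeGroup (Fin k)} {U : R.hor.Sub} (hU : R.FiniteAt w U) :
    ∀ X ∈ R.crown U, X.1.right = w := by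
  rintro X (⟨-, -, v, hv, h⟩ | ⟨-, -, v, hv, h⟩)
  · rw [← R.hor_tgt_right, ← h, hU.right v hv]
  · rw [← R.hor_src_right, ← h, hU.right v hv]

theorem crown_finite {w : FreeGroup (Fin k)} {U : R.hor.Sub} (hU : R.FiniteAt w U) :
    (R.crown U).Finite := by
  have h : (⋃ e : Fin r,
      ((fun v : R.Vtx => ((v.1 * (R.hz (R.label e))⁻¹, e) : R.HCell)) '' U.verts ∪
      (fun v : R.Vtx => ((v.1, e) : R.HCell)) '' U.verts)).Finite :=
    Set.finite_iUnion fun e => (hU.verts.image _).union (hU.verts.image _)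
  refine h.subset ?_
  rintro ⟨x, e⟩ (⟨-, -, v, hv, h⟩ | ⟨-, -, v, hv, h⟩)
  · refine Set.mem_iUnion.2 ⟨e, Or.inl ⟨v, hv, ?_⟩⟩
    simp [h, hor]
  · refine Set.mem_iUnion.2 ⟨e, Or.inr ⟨v, hv, ?_⟩⟩
    simp [h, hor]

/-- A finite subtree containing both `U` and its crown is unchanged by adding the crown, so it
belongs to the family whose intersection is the completion. -/
theorem FiniteAt.completion {w : FreeGroup (Fin k)} {U : R.hor.Sub} (hU : R.FiniteAt w U) :
    R.FiniteAt w (R.completion U) := by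
  let K := OGraph.Sub.span R.hor ∅ (R.crown U)
  have hK : R.FiniteAt w K := finiteAt_span Set.finite_empty (crown_finite hU) (by simp)
    (crown_right hU)
  have hUK : R.FiniteAt w (OGraph.Sub.sUnion {W | ∃ b : Bool, W = if b then U else K}) :=
    finiteAt_sUnion fun b => by cases b <;> simpa
  obtain ⟨S, hS, hUS, hf⟩ := hUK.exists_connected
  have hUS' : U.IsSub S := ⟨fun v hv => hUS.1 ⟨U, ⟨true, by simp⟩, hv⟩,
    fun X hX => hUS.2 ⟨U, ⟨true, by simp⟩, hX⟩⟩
  have hKS : K.IsSub S := ⟨fun v hv => hUS.1 ⟨K, ⟨false, by simp⟩, hv⟩,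
    fun X hX => hUS.2 ⟨K, ⟨false, by simp⟩, hX⟩⟩
  refine hf.mono (OGraph.Sub.smallest_isSub ⟨hS, hUS', ?_⟩)
  have hSK : OGraph.Sub.sUnion {S, K} = S := by
    apply OGraph.Sub.ext
    · ext v
      simpa [OGraph.Sub.sUnion] using fun h => hKS.1 h
    · ext X
      simpa [OGraph.Sub.sUnion] using fun h => hKS.2 h
  change (OGraph.Sub.sUnion {S, K}).Connected
  rw [hSK]
  exact hS

variable (R)

/-! ### Finiteness of tops and bottoms -/

theorem liftCells_right (g : R.G) (p : List (Fin r × Bool)) :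
    ∀ X ∈ R.liftCells g p, X.1.right = g.right := by
  induction p generalizing g with
  | nil => simp [liftCells]
  | cons s p ih =>
    obtain ⟨e, b⟩ := s
    intro X hX
    cases b
    · rcases List.mem_cons.1 hX with rfl | hX
      · simp [hz]
      · rw [ih _ X hX]; simp [hz]
    · rcases List.mem_cons.1 hX with rfl | hX
      · rfl
      · rw [ih _ X hX]; simp [hz]

theorem up_right (j : Fin k) (v : R.Vtx) :
    (R.up j v).1.right = v.1.right * FreeGroup.of j := by
  simp [up, t, hz]

theorem up_injective (j : Fin k) : Function.Injective (R.up j) := by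
  rintro ⟨g, u⟩ ⟨h, v⟩ H
  obtain ⟨H1, rfl⟩ := Prod.ext_iff.1 H
  simpa [up] using H1

theorem squareTop_right (j : Fin k) (E : R.HCell) :
    ∀ X ∈ R.squareTop j E, X.1.right = E.1.right * FreeGroup.of j := by
  intro X hX
  rw [R.liftCells_right _ _ X hX, up_right, hor_src_right]

theorem topCell_right (j : Fin k) (E : R.HCell) :
    (R.topCell j E).1.right = E.1.right * FreeGroup.of j :=
  R.squareTop_right j E _ (R.topCell_mem_squareTop j E)

/-- A bottom is a translate of some `(1, e)` by an element taking a cell of the finite top over `(1,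
e)` to `X`. By freeness that cell determines the element. -/
theorem Bot_finite (i : Fin k) (X : R.HCell) : (R.Bot i X).Finite := by
  have h : (⋃ e : Fin r, (fun Z : R.HCell => ((X.1 * Z.1⁻¹, e) : R.HCell)) ''
      {Z | Z ∈ R.squareTop i (1, e)}).Finite :=
    Set.finite_iUnion fun e => (List.finite_toSet _).image _
  refine h.subset ?_
  rintro ⟨g, e⟩ hY
  have hg : ((g, e) : R.HCell) = R.moveCell g (1, e) := by simp [moveCell]
  change X ∈ R.squareTop i (g, e) at hY
  rw [hg, squareTop_moveCell] at hY
  obtain ⟨Z, hZ, rfl⟩ := List.mem_map.1 hY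
  exact Set.mem_iUnion.2 ⟨e, Z, hZ, by simp [moveCell]⟩

theorem finiteAt_botAll (E : R.HCell) : R.FiniteAt E.1.right (R.botAll E) := by
  refine finiteAt_span Set.finite_empty (Set.finite_iUnion fun i => R.Bot_finite i _) (by simp) ?_
  intro X hX
  obtain ⟨i, hi⟩ := Set.mem_iUnion.1 hX
  -- Both cells lie under the same square-top level `w * t_i`, and `t_i` cancels on the right.
  have := (R.squareTop_right i X _ hi).symm.trans (R.topCell_right i E)
  exact mul_right_cancel this

variable {R}

theorem FiniteAt.cylTop {w : FreeGroup (Fin k)} {U : R.hor.Sub} (hU : R.FiniteAt w U)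
    (j : Fin k) : R.FiniteAt (w * FreeGroup.of j) (R.cylTop j U) := by
  refine finiteAt_span (hU.verts.image _) ?_ ?_ ?_
  · exact (hU.cells.biUnion fun Y _ => (R.squareTop j Y).finite_toSet).subset
      fun X ⟨Y, hY, hX⟩ => Set.mem_biUnion hY hX
  · rintro _ ⟨v, hv, rfl⟩
    rw [up_right, hU.right v hv]
  · rintro X ⟨Y, hY, hX⟩
    rw [R.squareTop_right j Y X hX, hU.cells_right hY]

variable (R)

theorem finiteAt_Top (E : R.HCell) : R.FiniteAt E.1.right (R.Top E) :=
  finiteAt_sUnion fun j => by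
    have h := ((R.finiteAt_botAll E).hull.cylTop j).moveSub (R.shift (R.topCell j E) E)
    -- The shift brings the top of the `j`-cylinder, one level up, back to the horizontal tree of
    -- `E`.
    have hw : (R.shift (R.topCell j E) E).right * (E.1.right * FreeGroup.of j) = E.1.right := by
      rw [← topCell_right, ← SemidirectProduct.mul_right, shift, inv_mul_cancel_right]
    rwa [hw] at h

theorem finiteAt_TopAt (i : Fin k) (E : R.HCell) :
    R.FiniteAt (E.1.right * FreeGroup.of i) (R.TopAt i E) := by
  have h := (R.finiteAt_Top E).moveSub (R.shift E (R.topCell i E))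
  rwa [← SemidirectProduct.mul_right, shift, inv_mul_cancel_right, topCell_right] at h

theorem finiteAt_Bottom (E : R.HCell) : R.FiniteAt E.1.right (R.Bottom E) := by
  refine FiniteAt.completion (finiteAt_span ?_ Set.finite_empty ?_ (by simp))
  · refine (Set.finite_iUnion fun i => ((R.finiteAt_TopAt i E).verts.preimage
      (R.up_injective i).injOn)).subset fun v ⟨i, hi⟩ => Set.mem_iUnion.2 ⟨i, hi⟩
  · rintro v ⟨i, hi⟩
    have := (R.finiteAt_TopAt i E).right _ hi
    rw [up_right] at this
    exact mul_right_cancel this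

/-! ### Finiteness of biblocks -/

theorem block_finite (ε : Bool) (I : Set (Fin k)) (E : R.HCell) : (R.block ε I E).Finite := by
  have h : ({R.cBottom ε I E} ∪ (Set.range (fun l => R.cTop ε ∅ (R.topCell l E)) ∪
      Set.range fun i => R.cTop (!ε) I (R.topCell i E))).Finite :=
    (Set.finite_singleton _).union ((Set.finite_range _).union (Set.finite_range _))
  refine h.subset ?_
  rintro P (rfl | ⟨-, l, rfl⟩ | ⟨i, -, rfl⟩)
  · exact Or.inl rfl
  · exact Or.inr (Or.inl ⟨l, rfl⟩)
  · exact Or.inr (Or.inr ⟨i, rfl⟩)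

theorem exists_finiteAt_of_mem_block {ε : Bool} {I : Set (Fin k)} {E : R.HCell}
    {P : R.ColoredTree} (hP : P ∈ R.block ε I E) : ∃ w, R.FiniteAt w P.dom := by
  rcases hP with rfl | ⟨-, l, rfl⟩ | ⟨i, -, rfl⟩
  · exact ⟨_, R.finiteAt_Bottom E⟩
  · exact ⟨_, R.finiteAt_Top _⟩
  · exact ⟨_, R.finiteAt_Top _⟩

theorem blockNuclei_finite (I : Set (Fin k)) (E : R.HCell) : (R.blockNuclei I E).Finite :=
  (Set.finite_range fun i => R.topCell i E).subset fun _ ⟨i, _, h⟩ => ⟨i, h.symm⟩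

variable {R}

namespace Biblock

variable (b : R.Biblock)

theorem blocks_finite : b.blocks.Finite := by
  obtain ⟨E, I, c⟩ := b
  cases c with
  | none => exact (Set.finite_singleton (true, ∅, E)).subset fun q hq => by simpa [blocks] using hq
  | some C =>
    exact (Set.toFinite {(true, ∅, E), (C.ε, I, C.Z E)}).subset fun q hq => by
      simpa [blocks] using hq

theorem parts_finite : b.parts.Finite :=
  (b.blocks_finite.biUnion fun q _ => R.block_finite q.1 q.2.1 q.2.2).subset
    fun _ ⟨_, hq, hP⟩ => Set.mem_biUnion hq hP

theorem exists_finiteAt_of_mem_parts {P : R.ColoredTree} (hP : P ∈ b.parts) :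
    ∃ w, R.FiniteAt w P.dom := by
  obtain ⟨q, -, hP⟩ := hP
  exact R.exists_finiteAt_of_mem_block hP

theorem union_verts_finite : b.union.verts.Finite := by
  refine (b.parts_finite.biUnion (t := fun P => P.dom.verts) fun P hP => ?_).subset ?_
  · obtain ⟨w, hw⟩ := b.exists_finiteAt_of_mem_parts hP
    exact hw.verts
  · rintro v ⟨_, ⟨P, hP, rfl⟩, hv⟩
    exact Set.mem_biUnion hP hv

theorem union_cells_finite : b.union.cells.Finite := by
  refine (b.parts_finite.biUnion (t := fun P => P.dom.cells) fun P hP => ?_).subset ?_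
  · obtain ⟨w, hw⟩ := b.exists_finiteAt_of_mem_parts hP
    exact hw.cells
  · rintro v ⟨_, ⟨P, hP, rfl⟩, hv⟩
    exact Set.mem_biUnion hP hv

theorem finiteAt_level_union (w : FreeGroup (Fin k)) : R.FiniteAt w (R.level w b.union) :=
  ⟨b.union_verts_finite.subset fun _ h => h.1, b.union_cells_finite.subset fun _ h => h.1,
    fun _ h => h.2⟩

theorem verts_finite : b.verts.Finite := by
  have hfin : {v | v ∈ (R.completion (R.level v.1.right b.union)).verts}.Finite := by
    refine ((b.union_verts_finite.image fun v => v.1.right).biUnion fun w _ =>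
      (b.finiteAt_level_union w).completion.verts).subset fun v hv => ?_
    by_cases h : ∃ u ∈ b.union.verts, u.1.right = v.1.right
    · exact Set.mem_biUnion h hv
    -- In a tree which the two blocks do not meet, the crown is empty too. The empty subgraph is
    -- then admissible, and the completion has no vertex there; only finitely many trees remain.
    · have hempty : (R.level v.1.right b.union).verts = ∅ :=
        Set.eq_empty_of_forall_notMem fun u hu => h ⟨u, hu.1, hu.2⟩
      have hv' := hv (OGraph.Sub.span R.hor ∅ ∅) ⟨?_, ⟨?_, ?_⟩, ?_⟩
      · simp [OGraph.Sub.span] at hv'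
      · simp [OGraph.Sub.Connected, OGraph.Sub.span]
      · simp [hempty]
      · intro X hX
        have := (R.level v.1.right b.union).src_mem X hX
        simp [hempty] at this
      · have hcr : R.crown (R.level v.1.right b.union) = ∅ := by
          simp [crown, Incoming, Outgoing, hempty]
        simp [hcr, OGraph.Sub.Connected, OGraph.Sub.sUnion, OGraph.Sub.span]
  obtain ⟨E, I, c⟩ := b
  cases c with
  | none => exact union_verts_finite _
  | some C => exact hfin

theorem elementaryCuts_finite : b.elementaryCuts.Finite := by
  have h1 := b.blocks_finite.biUnion fun q _ =>
    (R.blockNuclei_finite q.2.1 q.2.2).image (Sum.inl : R.HCell → R.HCell ⊕ R.VCell)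
  have h2 := Set.finite_iUnion fun i : Fin k =>
    b.verts_finite.image fun v => (Sum.inr (v.1, v.2, i) : R.HCell ⊕ R.VCell)
  refine (h1.union h2).subset ?_
  rintro c (⟨q, hq, N, hN, rfl⟩ | ⟨v, hv, i, -, rfl⟩)
  · exact Or.inl (Set.mem_biUnion hq ⟨N, hN, rfl⟩)
  · exact Or.inr (Set.mem_iUnion.2 ⟨i, v, hv, rfl⟩)

/-! ### Biblocks up to translation and cut sets through a given cell -/

/-- The twins which give the companion of `b`, if any, lie in the crown of the bottom. -/
def CompInCrown : Prop :=
  ∀ C, b.comp = some C → C.X ∈ R.crown (R.Bottom b.E) ∧ C.Y ∈ R.crown (R.Bottom b.E)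

/-- This consequence of `IsBiblock` suffices for counting, and spares translating the tied-set
condition and the maximality of the bridge. -/
theorem compInCrown_of_isBiblock (hb : R.IsBiblock b) : b.CompInCrown := by
  intro C hC
  obtain ⟨-, -, h⟩ := hb
  rw [hC] at h
  obtain ⟨-, ⟨⟨⟨⟨hX, hY, -⟩, -⟩, -⟩, -⟩, -⟩ := h
  exact ⟨Or.inl hX, Or.inr hY⟩

theorem CompInCrown.move {b : R.Biblock} (hb : b.CompInCrown) (g : R.G) :
    (b.move g).CompInCrown := by
  intro C hC
  obtain ⟨C, hC', rfl⟩ := Option.map_eq_some_iff.1 hC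
  simp only [Biblock.move, Companion.move, Bottom_moveCell, crown_moveSub]
  exact hb C hC'

theorem move_move (g h : R.G) : (b.move h).move g = b.move (g * h) := by
  obtain ⟨E, I, c⟩ := b
  have hm : ∀ X, R.moveCell g (R.moveCell h X) = R.moveCell (g * h) X := fun X => by
    simp [moveCell, mul_assoc]
  cases c <;> simp [move, Companion.move, hm]

theorem move_one : b.move 1 = b := by
  obtain ⟨E, I, c⟩ := b
  have hm : ∀ X, R.moveCell 1 X = X := fun X => by simp [moveCell]
  cases c <;> simp [move, Companion.move, hm]

variable (R) in
/-- There are finitely many biblocks centered at the cells of the base copy of the graph. -/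
theorem finite_representatives : {b : R.Biblock | b.E.1 = 1 ∧ b.CompInCrown}.Finite := by
  have hc : ∀ e : Fin r, (R.crown (R.Bottom (1, e))).Finite := fun e =>
    crown_finite (R.finiteAt_Bottom (1, e))
  -- The finite list of data: a label `e`, a subset `I`, and either no companion or two cells of the
  -- crown with the two booleans `bridgeIsX` and `ε`.
  have h := Set.finite_iUnion fun q : Fin r × Set (Fin k) =>
    (Set.finite_singleton (⟨(1, q.1), q.2, none⟩ : R.Biblock)).union
      (Set.finite_iUnion fun s : Bool × Bool =>
        ((hc q.1).prod (hc q.1)).image fun Z =>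
          (⟨(1, q.1), q.2, some ⟨Z.1, Z.2, s.1, s.2⟩⟩ : R.Biblock))
  refine h.subset ?_
  rintro ⟨⟨g, e⟩, I, c⟩ ⟨hg, hcr⟩
  obtain rfl : g = 1 := hg
  refine Set.mem_iUnion.2 ⟨(e, I), ?_⟩
  cases c with
  | none => exact Or.inl rfl
  | some C =>
    exact Or.inr (Set.mem_iUnion.2 ⟨(C.bridgeIsX, C.ε), (C.X, C.Y), hcr C rfl, rfl⟩)

/-- What is counted is cut sets, not biblocks. For each representative and each of its elementary
cuts `d'`, at most one `γ` takes `d'` to `d`, and the translate by this `γ` is the only cut set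
obtained. -/
theorem finite_cuts_through (κ : WallConvention) (d : R.HCell ⊕ R.VCell) :
    {S | ∃ b : R.Biblock, R.IsBiblock b ∧ S = b.cuts κ ∧ d ∈ S}.Finite := by
  have h : (⋃ b ∈ {b : R.Biblock | b.E.1 = 1 ∧ b.CompInCrown}, ⋃ d' ∈ b.elementaryCuts,
      (fun γ => moveEdge γ '' b.cuts κ) '' {γ | moveEdge γ d' = d}).Finite := by
    refine (finite_representatives R).biUnion fun b _ => b.elementaryCuts_finite.biUnion
      fun d' _ => Set.Finite.image _ (Set.Subsingleton.finite fun γ hγ γ' hγ' => ?_)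
    exact moveEdge_free (hγ.trans hγ'.symm)
  refine h.subset ?_
  rintro _ ⟨b, hb, rfl, hd⟩
  set g := b.E.1
  have hb' : (b.move g⁻¹).move g = b := by rw [move_move, mul_inv_cancel, move_one]
  set b' := b.move g⁻¹
  rw [← hb', cuts_move] at hd ⊢
  obtain ⟨_, ⟨γ, hγ, d', hd', rfl⟩, hd⟩ := hd
  -- The relevant translation is `g * γ`, which takes `d'` to `d`. Replacing `g` by it does not
  -- change the translated cut set, since `γ` stabilizes the cuts of `b'`.
  refine Set.mem_biUnion (x := b') ⟨?_, ((b.compInCrown_of_isBiblock hb).move g⁻¹)⟩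
    (Set.mem_biUnion hd' ⟨g * γ, ?_, ?_⟩)
  · simp [b', move, moveCell, g]
  · exact (moveEdge_mul g γ d').trans hd
  · calc moveEdge (g * γ) '' b'.cuts κ = moveEdge g '' (moveEdge γ '' b'.cuts κ) := by
          rw [Set.image_image]; simp only [moveEdge_mul]
      _ = _ := by rw [b'.moveEdge_image_cuts κ hγ]

end Biblock

end BFHRep

/-! ### Walls defined by parity of crossings -/

namespace OGraph

variable {V C : Type*} (Γ : OGraph V C) (S : Set C)

/-- The vertices joined to `a` by a path whose number of crossings with `S` has a given parity. -/
def side (odd : Bool) (a : V) : Set V :=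
  {v | ∃ p, Γ.IsPath a p v ∧ Nat.bodd (crossings S p) = odd}

variable {Γ S}

/-- Changing the base point along a path shifts all parities by the parity of that path. No
uniqueness of parity is assumed: a vertex may lie on both sides. -/
theorem mem_side_iff {a b : V} {o o' : Bool} (h : b ∈ Γ.side S o a) {v : V} :
    v ∈ Γ.side S o' a ↔ v ∈ Γ.side S (xor o o') b := by
  obtain ⟨p, hp, rfl⟩ := h
  constructor
  · rintro ⟨q, hq, rfl⟩
    exact ⟨_, hp.reverse.append hq, by rw [crossings_append, crossings_invRev, Nat.bodd_add]⟩
  · rintro ⟨q, hq, hq'⟩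
    exact ⟨_, hp.append hq, by rw [crossings_append, Nat.bodd_add, hq']; simp⟩

theorem side_eq {a b : V} {o : Bool} (h : b ∈ Γ.side S o a) (o' : Bool) :
    Γ.side S o' a = Γ.side S (xor o o') b :=
  Set.ext fun _ => mem_side_iff h

/-- The component of a vertex. -/
def component (Γ : OGraph V C) (a : V) : Set V := {v | ∃ p, Γ.IsPath a p v}

theorem side_eq_component {a : V} (h : a ∈ Γ.side S true a) (o : Bool) :
    Γ.side S o a = Γ.component a := by
  refine Set.Subset.antisymm (fun v ⟨p, hp, _⟩ => ⟨p, hp⟩) ?_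
  rintro v ⟨p, hp⟩
  by_cases ho : Nat.bodd (crossings S p) = o
  · exact ⟨p, hp, ho⟩
  -- Composing with the odd loop at `a` exchanges the two parities, so a path of the wrong parity
  -- also places `v` on the required side.
  · rw [side_eq h o]
    exact ⟨p, hp, by revert ho; cases Nat.bodd (crossings S p) <;> cases o <;> simp⟩

/-- A wall defined by a set of cuts and separating two vertices is determined by the set of cuts up
to the order of its sides; and its sides coincide unless the cuts meet a given path joining the two
vertices. -/
theorem wall_cases {a x y : V} {p : List (C × Bool)} (hp : Γ.IsPath x p y)
    (hsep : Separates (Γ.side S true a, Γ.side S false a) x y) :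
    (∃ o, (Γ.side S true a, Γ.side S false a) = (Γ.side S o x, Γ.side S (!o) x)) ∧
      ((∃ s ∈ p, s.1 ∈ S) ∨
        (Γ.side S true a, Γ.side S false a) = (Γ.component x, Γ.component x)) := by
  obtain ⟨o, hx, hy⟩ : ∃ o, x ∈ Γ.side S o a ∧ y ∈ Γ.side S (!o) a := by
    rcases hsep with ⟨h1, h2⟩ | ⟨h1, h2⟩
    · exact ⟨true, h1, h2⟩
    · exact ⟨false, h1, h2⟩
  refine ⟨⟨!o, by rw [side_eq hx true, side_eq hx false]; simp⟩, ?_⟩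
  by_cases hS : ∃ s ∈ p, s.1 ∈ S
  · exact Or.inl hS
  right
  push Not at hS
  -- Seen from `x`, the vertex `y` is reached by a path `q` with odd crossing; returning along `p`,
  -- which meets no cut, gives an odd loop at `x`.
  rw [side_eq hx] at hy
  obtain ⟨q, hq, hq'⟩ := hy
  have hxx : x ∈ Γ.side S true x := by
    refine ⟨_, hq.append hp.reverse, ?_⟩
    rw [crossings_append, crossings_invRev, crossings_eq_zero hS, Nat.add_zero, hq']
    simp
  rw [side_eq hx, side_eq hx, side_eq_component hxx, side_eq_component hxx]

/-- A family of walls given by sets of cuts, such that each cell belongs to finitely many sets of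
cuts, has finitely many members separating two given vertices. -/
theorem finite_walls_of_locally_finite {F : Set (V × Set C)}
    (hF : ∀ d, {S | ∃ a, (a, S) ∈ F ∧ d ∈ S}.Finite) (x y : V) :
    {W | (∃ q ∈ F, W = (Γ.side q.2 true q.1, Γ.side q.2 false q.1)) ∧
      Separates W x y}.Finite := by
  by_cases hxy : ∃ p, Γ.IsPath x p y
  · obtain ⟨p, hp⟩ := hxy
    have h : (⋃ s ∈ {s | s ∈ p}, ⋃ S ∈ {S | ∃ a, (a, S) ∈ F ∧ s.1 ∈ S},
        Set.range fun o => (Γ.side S o x, Γ.side S (!o) x)).Finite :=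
      p.finite_toSet.biUnion fun s _ => (hF s.1).biUnion fun _ _ => Set.finite_range _
    refine (h.union (Set.finite_singleton (Γ.component x, Γ.component x))).subset ?_
    rintro _ ⟨⟨⟨a, S⟩, hq, rfl⟩, hsep⟩
    obtain ⟨⟨o, ho⟩, ⟨s, hs, hsS⟩ | hc⟩ := wall_cases hp hsep
    · exact Or.inl (Set.mem_biUnion hs (Set.mem_biUnion ⟨a, hq, hsS⟩ ⟨o, ho.symm⟩))
    · exact Or.inr hc
  -- Both sides of a wall consist of vertices joined to its base point, so vertices in distinct
  -- components are never separated.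
  · convert Set.finite_empty
    refine Set.eq_empty_of_forall_notMem ?_
    rintro _ ⟨⟨⟨a, S⟩, -, rfl⟩, ⟨⟨p, hp, -⟩, q, hq, -⟩ | ⟨⟨p, hp, -⟩, q, hq, -⟩⟩
    · exact hxy ⟨_, hp.reverse.append hq⟩
    · exact hxy ⟨_, hp.reverse.append hq⟩

end OGraph

/-! ### Diagonal walls as parity walls -/

namespace BFHRep.Biblock

variable {n k r : ℕ} {V : Type*} {R : BFHRep n k r V} (b : R.Biblock) (κ : WallConvention)

theorem leftSide_eq : b.leftSide κ = R.skeleton.side (b.cuts κ) true (R.hor.tgt b.E) := by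
  simp only [leftSide, OGraph.side, Nat.odd_iff, Nat.mod_two_of_bodd]
  ext v
  refine exists_congr fun p => and_congr_right fun _ => ?_
  cases Nat.bodd (OGraph.crossings (b.cuts κ) p) <;> simp

theorem rightSide_eq : b.rightSide κ = R.skeleton.side (b.cuts κ) false (R.hor.tgt b.E) := by
  simp only [rightSide, OGraph.side, Nat.even_iff, Nat.mod_two_of_bodd]
  ext v
  refine exists_congr fun p => and_congr_right fun _ => ?_
  cases Nat.bodd (OGraph.crossings (b.cuts κ) p) <;> simp

end BFHRep.Biblock

theorem mainTheorem8 {n k r : ℕ} {V : Type*} [Finite V]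
    (σ : FreeGroup (Fin k) →* OutAut (FreeGroup (Fin n))) (hσ : Function.Injective σ)
    (hunip : ∀ t, IsUnipotentOut (σ t))
    (R : BFHRep n k r V) (hrep : ∀ j, (QuotientGroup.mk (R.α j) : OutAut _) = σ (FreeGroup.of j))
    (htied : R.IsTied) (hone : R.IsOneSided)
    (κ : WallConvention) (g g' : R.G) (v v' : V) :
    {W | W ∈ R.diagonalWalls κ ∧ Separates W (g, v) (g', v')}.Finite := by
  refine (OGraph.finite_walls_of_locally_finite (Γ := R.skeleton)
    (F := {q | ∃ b : R.Biblock, R.IsBiblock b ∧ q = (R.hor.tgt b.E, b.cuts κ)})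
    (fun d => ?_) (g, v) (g', v')).subset ?_
  · refine (BFHRep.Biblock.finite_cuts_through (R := R) κ d).subset ?_
    rintro S ⟨a, ⟨b, hb, h⟩, hd⟩
    exact ⟨b, hb, congrArg Prod.snd h, hd⟩
  · rintro _ ⟨⟨b, hb, rfl⟩, hsep⟩
    exact ⟨⟨_, ⟨b, hb, rfl⟩, by rw [b.leftSide_eq, b.rightSide_eq]⟩, hsep⟩
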